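/- **Setting.** Let $\Omega\subset\mathbb R^d$ be compact, let $\mathsf m$ be the underlying Borel measure on $\Omega$ (Lebesgue measure if $\Omega$ is a solid domain, surface measure if $\Omega$ is a surface; any Borel measure is allowed), and let $\mathsf w\ge 0$ be a weight on $\Omega$ with $\int_\Omega \mathsf w\,d\mathsf m=1$ for which $\langle f,g\rangle_{\mathsf w}=\int_\Omega f g\,\mathsf w\,d\mathsf m$ is an inner product on the space of polynomials restricted to $\Omega$. Let $\mathcal V_n(\Omega,\mathsf w)$ be the space of (restrictions to $\Omega$ of) polynomials of degree at most $n$ that are orthogonal to all polynomials of degree less than $n$, let $P_n(\mathsf w;\cdot,\cdot)$ be its reproducing kernel, and for $f\in L^1(\Omega,\mathsf w)$ put $$\operatorname{proj}_n(\mathsf w;f,x)=\int_\Omega f(y)P_n(\mathsf w;x,y)\mathsf w(y)\,d\mathsf m(y),\qquad S_n^\delta(\mathsf w;f,x)=\frac1{\binom{n+\delta}{n}}\sum_{k=0}^n\binom{n-k+\delta}{n-k}\operatorname{proj}_k(\mathsf w;f,x),$$ $$S_*^\delta(\mathsf w;f,x)=\sup_{n\ge0}\left|S_n^\delta(\mathsf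 w;f,x)\right|.$$ For $\alpha\ge\beta\ge-\frac12$ let $w_{\alpha,\beta}(t)=(1-t)^\alpha(1+t)^\beta$, let $P_n^{(\alpha,\beta)}$ be the Jacobi polynomials, orthogonal with respect to $w_{\alpha,\beta}$ on $[-1,1]$ and normalized by $P_n^{(\alpha,\beta)}(1)=\binom{n+\alpha}{n}$, let $h_n^{(\alpha,\beta)}$ be the square of the norm of $P_n^{(\alpha,\beta)}$ with respect to the probability measure proportional to $w_{\alpha,\beta}(t)\,dt$, and let $Z_n^{(\alpha,\beta)}(t)=P_n^{(\alpha,\beta)}(1)P_n^{(\alpha,\beta)}(t)/h_n^{(\alpha,\beta)}$. Suppose that $\mathsf w$ admits an addition formula with parameters $(\alpha,\beta)$: there are a positive integer $k$, a measurable function $\xi(x,y;u)\in[-1,1]$ of $x,y\in\Omega$, $u\in[-1,1]^k$, symmetric in $x$ and $y$, and a probability measure $\tau$ on $[-1,1]^k$ such that $$P_n(\mathsf w;x,y)=\int_{[-1,1]^k}Z_n^{(\alpha,\beta)}\big(\xi(x,y;u)\big)\,d\tau(u)\qquad(n\ge0,\ x,y\in\Omega).$$ For a function $g$ on $[-1,1]$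 put $(f*_{\mathsf w}g)(x)=\int_\Omega f(y)\Big(\int_{[-1,1]^k}g(\xi(x,y;u))\,d\tau(u)\Big)\mathsf w(y)\,d\mathsf m(y)$, and define the maximal function $$\mathscr M_{\mathsf w}f(x)=\sup_{0<\theta\le\pi}\frac{\big(|f|*_{\mathsf w}\chi_{[\cos\theta,1]}\big)(x)}{\int_0^\theta w_{\alpha,\beta}(\cos\phi)\sin\phi\,d\phi}\in[0,\infty].$$ **Theorem.** Let $\alpha\ge\beta\ge-\frac12$ and $\delta\ge\alpha+\beta+2$. There is a constant $c>0$, depending only on $\alpha,\beta,\delta$, such that for all $\Omega,\mathsf m,\mathsf w$ and every addition formula with parameters $(\alpha,\beta)$ as above, every $f\in L^1(\Omega,\mathsf w)$ and every $x\in\Omega$, $$S_*^\delta(\mathsf w;f,x)\le c\,\mathscr M_{\mathsf w}f(x).$$ -/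

import Mathlib

open MeasureTheory
open scoped ENNReal

noncomputable section

namespace FourierOrthogonal

/-! ### Jacobi polynomials -/

/-- The Jacobi polynomial `P_n^{(α,β)}`, orthogonal with respect to `(1 - t)^α (1 + t)^β` on
`[-1, 1]` and normalized by `P_n^{(α,β)}(1) = binom (n + α) n`. -/
def jacobiP (α β : ℝ) (n : ℕ) (t : ℝ) : ℝ :=
  ∑ k ∈ Finset.range (n + 1),
    Ring.choose ((n : ℝ) + α) (n - k) * Ring.choose ((n : ℝ) + β) k *
      ((t - 1) / 2) ^ k * ((t + 1) / 2) ^ (n - k)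

/-- `h_n^{(α,β)}`, the square of the norm of `P_n^{(α,β)}` in `L²` of the probability measure
proportional to `(1 - t)^α (1 + t)^β dt`, in closed form. The case `n = 0` is separate only because
the closed form reads `0 / 0` there when `α + β = -1`. -/
def jacobiNormSq (α β : ℝ) (n : ℕ) : ℝ :=
  if n = 0 then 1 else
    ((ascPochhammer ℝ n).eval (α + 1) * (ascPochhammer ℝ n).eval (β + 1) * (α + β + n + 1)) /
      ((n.factorial : ℝ) * (ascPochhammer ℝ n).eval (α + β + 2) * (α + β + 2 * n + 1))

/-- `Z_n^{(α,β)}(t) = P_n^{(α,β)}(1) P_n^{(α,β)}(t) / h_n^{(α,β)}`. -/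
def jacobiZ (α β : ℝ) (n : ℕ) (t : ℝ) : ℝ :=
  jacobiP α β n 1 * jacobiP α β n t / jacobiNormSq α β n

/-- `∫_0^θ w_{α,β}(cos φ) sin φ dφ` with `w_{α,β}(t) = (1 - t)^α (1 + t)^β`. -/
def jacobiMass (α β θ : ℝ) : ℝ :=
  ∫ φ in (0 : ℝ)..θ, (1 - Real.cos φ) ^ α * (1 + Real.cos φ) ^ β * Real.sin φ

/-! ### Orthogonal polynomials on a set `Ω ⊆ ℝ^d` with base measure `m` and weight `w` -/

section Orthogonal

variable {d : ℕ} {Ω : Set (EuclideanSpace ℝ (Fin d))}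

/-- The restriction to `Ω` of a polynomial in `d` variables. -/
def polyFun (Ω : Set (EuclideanSpace ℝ (Fin d))) (p : MvPolynomial (Fin d) ℝ) : Ω → ℝ :=
  fun x => MvPolynomial.eval (fun i => (x : EuclideanSpace ℝ (Fin d)) i) p

/-- `⟨f, g⟩_w = ∫_Ω f g w dm`. -/
def innerW (m : Measure Ω) (w f g : Ω → ℝ) : ℝ := ∫ x, f x * g x * w x ∂m

/-- `w` is a nonnegative weight with total mass one, for which `⟨·, ·⟩_w` is an inner product on the
polynomials restricted to `Ω`. -/
structure IsWeight (m : Measure Ω) (w : Ω → ℝ) : Prop where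
  nonneg : ∀ x, 0 ≤ w x
  integral_eq_one : ∫ x, w x ∂m = 1
  definite : ∀ p : MvPolynomial (Fin d) ℝ,
    innerW m w (polyFun Ω p) (polyFun Ω p) = 0 → polyFun Ω p = 0

/-- The space `V_n(Ω, w)` of orthogonal polynomials of degree `n`: restrictions to `Ω` of
polynomials of degree at most `n` that are orthogonal to all polynomials of lower degree. -/
def orthoPoly (m : Measure Ω) (w : Ω → ℝ) (n : ℕ) : Set (Ω → ℝ) :=
  {f | (∃ p : MvPolynomial (Fin d) ℝ, p.totalDegree ≤ n ∧ polyFun Ω p = f) ∧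
    ∀ q : MvPolynomial (Fin d) ℝ, q.totalDegree < n → innerW m w f (polyFun Ω q) = 0}

/-- `e` is an orthogonal basis of `V` with respect to `⟨·, ·⟩_w`. -/
structure IsOrthogonalBasis (m : Measure Ω) (w : Ω → ℝ) (V : Set (Ω → ℝ)) (N : ℕ)
    (e : Fin N → Ω → ℝ) : Prop where
  linearIndependent : LinearIndependent ℝ e
  span_eq : (Submodule.span ℝ (Set.range e) : Set (Ω → ℝ)) = V
  orthogonal : ∀ i j, i ≠ j → innerW m w (e i) (e j) = 0

open Classical in
/-- The reproducing kernel `P_n(w; x, y) = ∑_j e_j(x) e_j(y) / ⟨e_j, e_j⟩_w` of `V_n(Ω, w)`, for an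
orthogonal basis `e` of `V_n(Ω, w)`. The sum does not depend on the basis, and a basis exists for
every weight on a compact set. -/
def reproKernel (m : Measure Ω) (w : Ω → ℝ) (n : ℕ) (x y : Ω) : ℝ :=
  if h : ∃ (N : ℕ) (e : Fin N → Ω → ℝ), IsOrthogonalBasis m w (orthoPoly m w n) N e then
    ∑ j, h.choose_spec.choose j x * h.choose_spec.choose j y /
      innerW m w (h.choose_spec.choose j) (h.choose_spec.choose j)
  else 0

/-- `proj_n(w; f, x) = ∫_Ω f(y) P_n(w; x, y) w(y) dm(y)`. -/
def proj (m : Measure Ω) (w : Ω → ℝ) (n : ℕ) (f : Ω → ℝ) (x : Ω) : ℝ :=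
  ∫ y, f y * reproKernel m w n x y * w y ∂m

/-- The Cesàro `(C, δ)` means `S_n^δ(w; f, x)`. -/
def cesaroMean (m : Measure Ω) (w : Ω → ℝ) (δ : ℝ) (n : ℕ) (f : Ω → ℝ) (x : Ω) : ℝ :=
  (Ring.choose ((n : ℝ) + δ) n)⁻¹ *
    ∑ k ∈ Finset.range (n + 1), Ring.choose (((n - k : ℕ) : ℝ) + δ) (n - k) * proj m w k f x

/-- The maximal Cesàro operator `S_*^δ(w; f, x) = sup_n |S_n^δ(w; f, x)|`, a value in `[0, ∞]`. -/
def cesaroMax (m : Measure Ω) (w : Ω → ℝ) (δ : ℝ) (f : Ω → ℝ) (x : Ω) : ℝ≥0∞ :=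
  ⨆ n : ℕ, ENNReal.ofReal |cesaroMean m w δ n f x|

/-- The data of an addition formula with parameters `(α, β)`: a positive integer `k`, a function
`ξ(x, y; u) ∈ [-1, 1]` of `x, y ∈ Ω` and `u ∈ [-1, 1]^k` that is symmetric in `x` and `y`, and a
probability measure `τ` on `[-1, 1]^k`, such that
`P_n(w; x, y) = ∫ Z_n^{(α,β)}(ξ(x, y; u)) dτ(u)` for all `n`. -/
structure AdditionFormula (m : Measure Ω) (w : Ω → ℝ) (α β : ℝ) where
  k : ℕ
  k_pos : 0 < k
  ξ : Ω → Ω → (Fin k → Set.Icc (-1 : ℝ) 1) → Set.Icc (-1 : ℝ) 1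
  τ : Measure (Fin k → Set.Icc (-1 : ℝ) 1)
  isProbabilityMeasure : IsProbabilityMeasure τ
  measurable : ∀ x, Measurable fun q : Ω × (Fin k → Set.Icc (-1 : ℝ) 1) => ξ x q.1 q.2
  symm : ∀ x y u, ξ x y u = ξ y x u
  formula : ∀ (n : ℕ) (x y : Ω), reproKernel m w n x y = ∫ u, jacobiZ α β n (ξ x y u) ∂τ

namespace AdditionFormula

variable {m : Measure Ω} {w : Ω → ℝ} {α β : ℝ}

/-- `T^{(α,β)} g(x, y) = ∫ g(ξ(x, y; u)) dτ(u)`. -/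
def T (A : AdditionFormula m w α β) (g : ℝ → ℝ) (x y : Ω) : ℝ := ∫ u, g (A.ξ x y u) ∂A.τ

/-- The convolution `(f *_w g)(x) = ∫_Ω f(y) T^{(α,β)} g(x, y) w(y) dm(y)`. -/
def conv (A : AdditionFormula m w α β) (f : Ω → ℝ) (g : ℝ → ℝ) (x : Ω) : ℝ :=
  ∫ y, f y * A.T g x y * w y ∂m

/-- The maximal function
`sup_θ (|f| *_w χ_{[cos θ, 1]})(x) / ∫_0^θ w_{α,β}(cos φ) sin φ dφ`, a value in `[0, ∞]`.
The supremum is over `0 < θ ≤ π`; at `θ = 0` the quotient would read `0 / 0`. -/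
def maximalFunction (A : AdditionFormula m w α β) (f : Ω → ℝ) (x : Ω) : ℝ≥0∞ :=
  ⨆ θ ∈ Set.Ioc 0 Real.pi,
    ENNReal.ofReal
      (A.conv (fun y => |f y|) ((Set.Icc (Real.cos θ) 1).indicator 1) x / jacobiMass α β θ)

end AdditionFormula

end Orthogonal

end FourierOrthogonal

end

noncomputable section

namespace FourierOrthogonal

/-! ### Rising binomial coefficients and binomial series -/

/-! Cesàro means of order δ are convex combinations of those of order d = α + β + 2
(`abs_cesaroMean_le_of_le`), so only order d matters. The addition formula turns the means of order
d into convolutions of f with the one-variable kernel K_n = `cesaroKernel` (`cesaroMean_eq_conv`),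
and the polynomials on Ω play no further role. If |K_n| is dominated on [-1, 1] by a sum of c_j
χ_[cos θ_j, 1] with ∑ c_j · mass(θ_j) bounded uniformly in n, the theorem follows by applying the
definition of the maximal function to each cap (`abs_conv_le_of_caps`).

Such a domination comes from the pointwise bound `exists_abs_cesaroKernel_le`: with N = n + 1 and
some 0 < η < 1, |K_n(t)| ≤ C N^(η-1) (N^(-2) + (1-t)/2)^(-(α+3/2-η/2)). On the caps of radius 2^j /
N this gives c_j · mass(θ_j) of order at most 2^(j(η-1)), a geometric series.

For the pointwise bound, put t = 2x² - 1. The partial sum of Z_0, ..., Z_j is the average of the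
Gegenbauer polynomial C_{2j}^{(d)}(xu) over a probability measure in u on [0, 1]
(`jacobiSum_eq_integral`). Summing over j, K_n is up to normalization the average over u of the
coefficient of r^(2n) in ((1 - r²)(1 - 2ry + r²))^(-d), with y = xu = cos ψ. This function has the
four singular points ±1, exp(±iψ) on the unit circle. A Cauchy estimate on a circle at distance
about 1/N from it, together with the separation of these points (`rpow_neg_four_le`), yields
`exists_abs_cesaroGegenbauer_le`. The average over u then improves the exponent by β + 1/2, which is
the `decay` field of `IsUltrasphericalMeasure`.

The small η > 0 keeps the exponent d + η above 1, so that no logarithm appears even when d = 1, that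
is α = β = -1/2. -/

/-- `(s)_n / n!`, the coefficient of `X ^ n` in `(1 - X) ^ (-s)`. -/
def risingCoeff {K : Type*} [Field K] (s : K) (n : ℕ) : K :=
  (ascPochhammer K n).eval s / (n.factorial : K)

@[simp] theorem risingCoeff_zero {K : Type*} [Field K] (s : K) : risingCoeff s 0 = 1 := by
  simp [risingCoeff]

theorem risingCoeff_succ {K : Type*} [Field K] [CharZero K] (s : K) (n : ℕ) :
    ((n : K) + 1) * risingCoeff s (n + 1) = (s + n) * risingCoeff s n := by
  have h1 : (n.factorial : K) ≠ 0 := by exact_mod_cast n.factorial_ne_zero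
  have h2 : (n : K) + 1 ≠ 0 := by exact_mod_cast n.succ_ne_zero
  rw [risingCoeff, risingCoeff, ascPochhammer_succ_eval, Nat.factorial_succ]
  push_cast
  field_simp

theorem choose_eq_risingCoeff {K : Type*} [Field K] [CharZero K] [BinomialRing K]
    (s : K) (n : ℕ) : Ring.choose (s + n - 1) n = risingCoeff s n := by
  have h1 : (n.factorial : K) ≠ 0 := by exact_mod_cast n.factorial_ne_zero
  rw [← Ring.multichoose_eq, risingCoeff, eq_div_iff h1, mul_comm, ← nsmul_eq_mul,
    Ring.factorial_nsmul_multichoose_eq_ascPochhammer, Polynomial.ascPochhammer_smeval_eq_eval]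

theorem ofReal_risingCoeff (s : ℝ) (n : ℕ) :
    ((risingCoeff s n : ℝ) : ℂ) = risingCoeff (s : ℂ) n := by
  induction n with
  | zero => simp
  | succ n ih =>
    have h2 : (n : ℂ) + 1 ≠ 0 := by exact_mod_cast n.succ_ne_zero
    apply mul_left_cancel₀ h2
    rw [risingCoeff_succ, ← ih]
    have := congrArg (fun x : ℝ => (x : ℂ)) (risingCoeff_succ s n)
    push_cast at this
    exact this

theorem risingCoeff_nonneg {s : ℝ} (hs : 0 ≤ s) (n : ℕ) : 0 ≤ risingCoeff s n := by
  induction n with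
  | zero => simp
  | succ n ih =>
    have h2 : (0 : ℝ) < (n : ℝ) + 1 := by positivity
    have := risingCoeff_succ s n
    refine nonneg_of_mul_nonneg_right ?_ h2
    rw [this]; positivity

theorem risingCoeff_pos {s : ℝ} (hs : 0 < s) (n : ℕ) : 0 < risingCoeff s n :=
  div_pos (ascPochhammer_pos n s hs) (by positivity)

section Series

variable {K : Type*} [Field K]

open PowerSeries

/-- The formal power series `(1 - ζ X) ^ (-s)`. -/
def geomPow (s ζ : K) : K⟦X⟧ := PowerSeries.mk fun n => ζ ^ n * risingCoeff s n

theorem constantCoeff_geomPow (s ζ : K) : constantCoeff (geomPow s ζ) = 1 := by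
  rw [← coeff_zero_eq_constantCoeff_apply, geomPow, coeff_mk]; simp

theorem derivative_geomPow [CharZero K] (s ζ : K) :
    (1 - C ζ * X) * derivative K (geomPow s ζ) = C (ζ * s) * geomPow s ζ := by
  ext n
  rw [sub_mul, one_mul, map_sub, mul_assoc, coeff_C_mul, coeff_C_mul]
  cases n with
  | zero =>
    have := risingCoeff_succ s 0
    simp only [coeff_zero_X_mul, coeff_derivative, geomPow, coeff_mk]
    norm_num at this ⊢
    rw [this]; exact Or.inl rfl
  | succ n =>
    have := risingCoeff_succ s (n + 1)
    simp only [coeff_succ_X_mul, coeff_derivative, geomPow, coeff_mk]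
    push_cast at this ⊢
    linear_combination ζ ^ (n + 1 + 1) * this

/-- Uniqueness for a first-order linear differential equation: the quotient of two solutions has
derivative zero. It replaces manipulations of coefficients in the two product formulas for binomial
series. -/
theorem series_eq_of_derivative [CharZero K] {P Q G H : K⟦X⟧} (hP : constantCoeff P = 1)
    (hG : P * derivative K G = Q * G) (hH : P * derivative K H = Q * H)
    (hG0 : constantCoeff G = 1) (hH0 : constantCoeff H = 1) : G = H := by
  have hP0 : P ≠ 0 := by
    rintro rfl; simp at hP
  have hHne : constantCoeff H ≠ 0 := by rw [hH0]; exact one_ne_zero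
  have hcross : derivative K G * H = G * derivative K H := by
    apply mul_left_cancel₀ hP0
    linear_combination H * hG - G * hH
  have hone : G * H⁻¹ = 1 := by
    apply PowerSeries.derivative.ext
    · rw [Derivation.leibniz, PowerSeries.derivative_inv', Derivation.map_one_eq_zero]
      have hinv := PowerSeries.mul_inv_cancel H hHne
      simp only [smul_eq_mul]
      linear_combination (H⁻¹ ^ 2) * hcross - (H⁻¹ * derivative K G) * hinv
    · simp [hG0, hH0]
  calc G = G * (H⁻¹ * H) := by rw [PowerSeries.inv_mul_cancel H hHne, mul_one]
    _ = H := by rw [← mul_assoc, hone, one_mul]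

theorem geomPow_mul_geomPow [CharZero K] (s t ζ : K) :
    geomPow s ζ * geomPow t ζ = geomPow (s + t) ζ := by
  refine series_eq_of_derivative (P := 1 - C ζ * X) (Q := C (ζ * (s + t))) (by simp) ?_
    (derivative_geomPow _ _) (by simp [constantCoeff_geomPow]) (constantCoeff_geomPow _ _)
  have h1 := derivative_geomPow s ζ
  have h2 := derivative_geomPow t ζ
  rw [Derivation.leibniz, smul_eq_mul, smul_eq_mul]
  simp only [mul_add, map_mul, map_add] at h1 h2 ⊢
  linear_combination (geomPow t ζ) * h1 + (geomPow s ζ) * h2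

theorem risingCoeff_add [CharZero K] (s t : K) (n : ℕ) :
    ∑ p ∈ Finset.HasAntidiagonal.antidiagonal n, risingCoeff s p.1 * risingCoeff t p.2 =
      risingCoeff (s + t) n := by
  have := congrArg (coeff n) (geomPow_mul_geomPow s t 1)
  simpa [coeff_mul, geomPow] using this

/-- `(1 - p X + q X²) ^ (-s)`, as a substitution into the binomial series. -/
def quadPow (s p q : K) : K⟦X⟧ := (geomPow s 1).subst (X * (C p - C q * X) : K⟦X⟧)

theorem hasSubst_quad (p q : K) : HasSubst (X * (C p - C q * X) : K⟦X⟧) :=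
  HasSubst.of_constantCoeff_zero' (by simp)

/-- Both sides solve the same first-order equation. The product of linear factors is convenient for
analytic estimates, the quadratic form for explicit coefficients; this identity links the two. -/
theorem geomPow_mul_eq_quadPow [CharZero K] (s ζ η : K) :
    geomPow s ζ * geomPow s η = quadPow s (ζ + η) (ζ * η) := by
  have hs := hasSubst_quad (ζ + η) (ζ * η)
  refine series_eq_of_derivative (P := 1 - X * (C (ζ + η) - C (ζ * η) * X))
    (Q := C s * (C (ζ + η) - 2 * C (ζ * η) * X)) (by simp) ?_ ?_
    (by simp [constantCoeff_geomPow]) ?_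
  · have h1 := derivative_geomPow s ζ
    have h2 := derivative_geomPow s η
    rw [Derivation.leibniz, smul_eq_mul, smul_eq_mul]
    simp only [map_mul, map_add] at h1 h2 ⊢
    linear_combination (1 - C η * X) * (geomPow s η) * h1 + (1 - C ζ * X) * (geomPow s ζ) * h2
  · have h0 := derivative_geomPow s 1
    have hd : derivative K (X * (C (ζ + η) - C (ζ * η) * X) : K⟦X⟧) =
        C (ζ + η) - 2 * C (ζ * η) * X := by
      simp only [Derivation.leibniz, map_sub, smul_eq_mul, derivative_C, derivative_X]
      ring
    rw [quadPow, derivative_subst hs, hd]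
    generalize X * (C (ζ + η) - C (ζ * η) * X) = b at hs ⊢
    have h1 := congrArg (substAlgHom hs) h0
    have hX : (substAlgHom hs) (X : K⟦X⟧) = b := by rw [coe_substAlgHom, subst_X hs]
    have hC : ∀ a : K, (substAlgHom hs) (C a) = C a := (substAlgHom hs).commutes
    simp only [map_mul, map_sub, map_one, one_mul, hX, hC] at h1
    rw [← coe_substAlgHom hs]
    linear_combination (C (ζ + η) - 2 * C (ζ * η) * X) * h1
  · rw [quadPow, ← coeff_zero_eq_constantCoeff_apply, coeff_subst' hs, finsum_eq_single _ 0]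
    · simp [geomPow]
    · intro d hd
      simp [mul_pow, hd]

theorem coeff_linear_pow (p q : K) (d e : ℕ) :
    coeff e ((C p - C q * X : K⟦X⟧) ^ d) = (d.choose e : K) * (-q) ^ e * p ^ (d - e) := by
  rw [sub_eq_neg_add, add_pow, map_sum]
  have : ∀ m ∈ Finset.range (d + 1), coeff e ((-(C q * X)) ^ m * (C p) ^ (d - m) *
      ((d.choose m : ℕ) : K⟦X⟧)) = if e = m then (d.choose e : K) * (-q) ^ e * p ^ (d - e) else 0 := by
    intro m _
    rw [show ((-(C q * X)) ^ m * (C p) ^ (d - m) * ((d.choose m : ℕ) : K⟦X⟧)) =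
      C ((d.choose m : K) * (-q) ^ m * p ^ (d - m)) * X ^ m by
        simp only [map_mul, map_pow, map_neg, map_natCast]; ring]
    rw [coeff_C_mul, coeff_X_pow]
    split_ifs with h
    · subst h; ring
    · ring
  rw [Finset.sum_congr rfl this, Finset.sum_ite_eq]
  split_ifs with h
  · rfl
  · rw [Nat.choose_eq_zero_of_lt (by simpa using h)]; simp

theorem coeff_quadPow_even (s p q : K) (j : ℕ) :
    coeff (2 * j) (quadPow s p q) = ∑ i ∈ Finset.range (j + 1),
      risingCoeff s (j + i) * ((j + i).choose (j - i) : K) * (-q) ^ (j - i) * p ^ (2 * i) := by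
  rw [quadPow, coeff_subst' (hasSubst_quad p q)]
  -- The power X^d (p - qX)^d has order at least d and degree at most 2d, so only j ≤ d ≤ 2j
  -- contributes to degree 2j.
  rw [finsum_eq_sum_of_support_subset (s := Finset.Ico j (j + (j + 1)))]
  · rw [Finset.sum_Ico_eq_sum_range]
    simp only [Nat.add_sub_cancel_left]
    refine Finset.sum_congr rfl fun i hi => ?_
    have hi' : i ≤ j := Nat.lt_succ_iff.mp (Finset.mem_range.mp hi)
    rw [mul_pow, coeff_X_pow_mul', if_pos (by omega), coeff_linear_pow, geomPow, coeff_mk,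
      show 2 * j - (j + i) = j - i by omega, show j + i - (j - i) = 2 * i by omega, smul_eq_mul]
    ring
  · intro d hd
    simp only [Finset.coe_Ico, Set.mem_Ico]
    by_contra hcon
    apply hd
    change _ • _ = _
    rw [mul_pow, coeff_X_pow_mul']
    split_ifs with h
    · rw [coeff_linear_pow, Nat.choose_eq_zero_of_lt (by omega)]; simp
    · simp

theorem coeff_quadPow_zero_neg_one (s : K) (n : ℕ) :
    coeff n (quadPow s 0 (-1)) = if 2 ∣ n then risingCoeff s (n / 2) else 0 := by
  have : (X * (C 0 - C (-1) * X) : K⟦X⟧) = X ^ 2 := by simp; ring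
  rw [quadPow, this, coeff_subst_X_pow two_ne_zero]
  simp [geomPow]

end Series

/-! ### Expansions of Jacobi polynomials at `t = -1` -/

/-- Chu–Vandermonde, after binom(b, k) binom(k, e) = binom(b, e) binom(b - e, k - e). -/
theorem sum_choose_mul_choose_mul_choose (a b : ℝ) {n e : ℕ} (he : e ≤ n) :
    ∑ k ∈ Finset.range (n + 1), Ring.choose a (n - k) * Ring.choose b k * (k.choose e : ℝ) =
      Ring.choose b e * Ring.choose (a + b - e) (n - e) := by
  have hsub : ∀ k ∈ Finset.range (n + 1), k ∉ Finset.Ico e (e + (n - e + 1)) →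
      Ring.choose a (n - k) * Ring.choose b k * (k.choose e : ℝ) = 0 := by
    intro k hk hk'
    rw [Finset.mem_range] at hk
    rw [Finset.mem_Ico] at hk'
    rw [Nat.choose_eq_zero_of_lt (by omega)]; simp
  rw [← Finset.sum_subset (s₁ := Finset.Ico e (e + (n - e + 1))) (by
    intro k hk
    rw [Finset.mem_Ico] at hk
    rw [Finset.mem_range]; omega) hsub, Finset.sum_Ico_eq_sum_range, Nat.add_sub_cancel_left,
    show a + b - (e : ℝ) = (b - e) + a by ring,
    Ring.add_choose_eq (n - e) (Commute.all (b - (e : ℝ)) a),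
    Finset.Nat.sum_antidiagonal_eq_sum_range_succ
      (fun i j => Ring.choose (b - (e : ℝ)) i * Ring.choose a j), Finset.mul_sum]
  refine Finset.sum_congr rfl fun j _ => ?_
  have := Ring.choose_smul_choose b (Nat.le_add_right e j)
  rw [nsmul_eq_mul, Nat.add_sub_cancel_left] at this
  rw [show n - (e + j) = n - e - j by omega]
  linear_combination (Ring.choose a (n - e - j)) * this

/-- Write (t - 1)/2 = -1 + (t + 1)/2, expand, and sum over the original index first. -/
theorem jacobiP_eq_sum (α β : ℝ) (n : ℕ) (t : ℝ) :
    jacobiP α β n t = ∑ i ∈ Finset.range (n + 1), (-1) ^ (n - i) *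
      (Ring.choose ((n : ℝ) + β) (n - i) * Ring.choose ((n : ℝ) + i + α + β) i) *
        ((t + 1) / 2) ^ i := by
  have hterm : ∀ k ∈ Finset.range (n + 1),
      Ring.choose ((n : ℝ) + α) (n - k) * Ring.choose ((n : ℝ) + β) k *
      ((t - 1) / 2) ^ k * ((t + 1) / 2) ^ (n - k) =
      ∑ e ∈ Finset.range (n + 1), (-1) ^ e * ((t + 1) / 2) ^ (n - e) *
        (Ring.choose ((n : ℝ) + α) (n - k) * Ring.choose ((n : ℝ) + β) k * (k.choose e : ℝ)) := by
    intro k hk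
    have hk' : k ≤ n := Nat.lt_succ_iff.mp (Finset.mem_range.mp hk)
    have hsub : Finset.range (k + 1) ⊆ Finset.range (n + 1) := by
      intro i hi; rw [Finset.mem_range] at *; omega
    rw [← Finset.sum_subset hsub (by
      intro e _ he
      rw [Finset.mem_range] at he
      rw [Nat.choose_eq_zero_of_lt (by omega)]; simp)]
    rw [show (t - 1) / 2 = -1 + (t + 1) / 2 by ring, add_pow, Finset.mul_sum, Finset.sum_mul]
    refine Finset.sum_congr rfl fun e he => ?_
    have he' : e ≤ k := Nat.lt_succ_iff.mp (Finset.mem_range.mp he)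
    rw [show n - e = (k - e) + (n - k) by omega, pow_add]
    ring
  rw [jacobiP, Finset.sum_congr rfl hterm, Finset.sum_comm, ← Finset.sum_range_reflect]
  refine Finset.sum_congr rfl fun i hi => ?_
  have hi' : i ≤ n := Nat.lt_succ_iff.mp (Finset.mem_range.mp hi)
  rw [← Finset.mul_sum, show n + 1 - 1 - i = n - i by omega,
    sum_choose_mul_choose_mul_choose _ _ (Nat.sub_le n i), show n - (n - i) = i by omega,
    Nat.cast_sub hi', show (n : ℝ) + α + (n + β) - (n - i) = (n : ℝ) + i + α + β by ring]
  ring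

theorem eval_ascPochhammer_add (s : ℝ) (m k : ℕ) :
    (ascPochhammer ℝ (m + k)).eval s =
      (ascPochhammer ℝ m).eval s * (ascPochhammer ℝ k).eval (s + m) := by
  rw [← ascPochhammer_mul]; simp [Polynomial.eval_comp]

/-- The partial sum `∑_{k ≤ j} Z_k^{(α,β)}`, as a polynomial in `X = (1 + t) / 2`. -/
def jacobiSum (α β : ℝ) (j : ℕ) (X : ℝ) : ℝ :=
  ∑ i ∈ Finset.range (j + 1), (-1) ^ (j - i) * (ascPochhammer ℝ (j + i)).eval (α + β + 2) /
    ((j - i).factorial * i.factorial * (ascPochhammer ℝ i).eval (β + 1)) * X ^ i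

theorem jacobiP_one (α β : ℝ) (n : ℕ) : jacobiP α β n 1 = risingCoeff (α + 1) n := by
  rw [jacobiP, Finset.sum_eq_single 0]
  · rw [← choose_eq_risingCoeff]
    simp only [Nat.sub_zero, Ring.choose_zero_right]
    norm_num
    congr 1; ring
  · intro k _ hk
    rw [sub_self, zero_div, zero_pow hk]; ring
  · simp

theorem jacobiZ_zero (α β t : ℝ) : jacobiZ α β 0 t = jacobiSum α β 0 ((t + 1) / 2) := by
  simp [jacobiZ, jacobiP, jacobiNormSq, jacobiSum]

/-- The shift to degree n + 1 avoids the special case of `jacobiNormSq` and makes the cancelled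
factor α + β + 2 + n positive. -/
theorem jacobiZ_coeff {α β : ℝ} (hα : -1 < α) (hβ : -1 < β) {n i : ℕ}
    (hi : i ≤ n + 1) :
    jacobiP α β (n + 1) 1 * (Ring.choose (((n + 1 : ℕ) : ℝ) + β) (n + 1 - i) *
      Ring.choose (((n + 1 : ℕ) : ℝ) + i + α + β) i) / jacobiNormSq α β (n + 1) =
    (α + β + 2 + 2 * n + 1) * (ascPochhammer ℝ (n + i)).eval (α + β + 2) /
      ((n + 1 - i).factorial * i.factorial * (ascPochhammer ℝ i).eval (β + 1)) := by
  obtain ⟨l, hl⟩ := Nat.exists_eq_add_of_le hi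
  have hl' : n + 1 - i = l := by omega
  have hR : (i : ℝ) + l = n + 1 := by exact_mod_cast hl.symm
  have p1 := ascPochhammer_pos (n + 1) (α + 1) (by linarith)
  have p2 := ascPochhammer_pos i (β + 1) (by linarith)
  have p2' := ascPochhammer_pos l (β + 1 + i) (by have : (0:ℝ) ≤ i := by positivity
                                                  linarith)
  have p3 := ascPochhammer_pos n (α + β + 2) (by linarith)
  have hn : (0 : ℝ) ≤ n := by positivity
  have e1 : Ring.choose (((n + 1 : ℕ) : ℝ) + β) (n + 1 - i) = risingCoeff (β + 1 + i) l := by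
    rw [hl', ← choose_eq_risingCoeff]
    congr 1
    push_cast
    linarith
  have e2 : Ring.choose (((n + 1 : ℕ) : ℝ) + i + α + β) i = risingCoeff (α + β + 2 + n) i := by
    rw [← choose_eq_risingCoeff]
    congr 1
    push_cast
    ring
  have e3 : (ascPochhammer ℝ (n + 1)).eval (β + 1) =
      (ascPochhammer ℝ i).eval (β + 1) * (ascPochhammer ℝ l).eval (β + 1 + i) := by
    rw [hl, eval_ascPochhammer_add]
  have q1 : (0 : ℝ) < α + β + 2 + n := by linarith
  have q2 : (0 : ℝ) < α + β + 2 + 2 * n + 1 := by linarith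
  rw [jacobiP_one, e1, e2, jacobiNormSq, if_neg (Nat.succ_ne_zero n), e3, hl',
    eval_ascPochhammer_add (α + β + 2) n i, ascPochhammer_succ_eval n (α + β + 2), risingCoeff,
    risingCoeff, risingCoeff]
  push_cast
  rw [show α + β + ((n : ℝ) + 1) + 1 = α + β + 2 + n by ring,
    show α + β + 2 * ((n : ℝ) + 1) + 1 = α + β + 2 + 2 * n + 1 by ring]
  have f1 : ((n + 1).factorial : ℝ) ≠ 0 := by exact_mod_cast (n + 1).factorial_ne_zero
  have f2 : (i.factorial : ℝ) ≠ 0 := by exact_mod_cast i.factorial_ne_zero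
  have f3 : (l.factorial : ℝ) ≠ 0 := by exact_mod_cast l.factorial_ne_zero
  have := p1.ne'
  have := p2.ne'
  have := p2'.ne'
  have := p3.ne'
  field_simp

/-- By Christoffel–Darboux the partial sum is a multiple of P_n^{(α+1,β)}; here its closed form is
checked by differencing coefficients in powers of (1 + t)/2. -/
theorem jacobiZ_succ {α β : ℝ} (hα : -1 < α) (hβ : -1 < β) (n : ℕ) (t : ℝ) :
    jacobiZ α β (n + 1) t =
      jacobiSum α β (n + 1) ((t + 1) / 2) - jacobiSum α β n ((t + 1) / 2) := by
  have hL : jacobiZ α β (n + 1) t = ∑ i ∈ Finset.range (n + 1 + 1), (-1) ^ (n + 1 - i) *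
      ((α + β + 2 + 2 * n + 1) * (ascPochhammer ℝ (n + i)).eval (α + β + 2) /
      ((n + 1 - i).factorial * i.factorial * (ascPochhammer ℝ i).eval (β + 1))) *
      ((t + 1) / 2) ^ i := by
    rw [jacobiZ, jacobiP_eq_sum α β (n + 1) t, Finset.mul_sum, Finset.sum_div]
    refine Finset.sum_congr rfl fun i hi => ?_
    rw [← jacobiZ_coeff hα hβ (Nat.lt_succ_iff.mp (Finset.mem_range.mp hi))]
    ring
  rw [hL, jacobiSum, jacobiSum, Finset.sum_range_succ, Finset.sum_range_succ _ (n + 1),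
    add_sub_right_comm, ← Finset.sum_sub_distrib]
  congr 1
  · refine Finset.sum_congr rfl fun i hi => ?_
    obtain ⟨l, rfl⟩ := Nat.exists_eq_add_of_le (Nat.lt_succ_iff.mp (Finset.mem_range.mp hi))
    have p2 := (ascPochhammer_pos i (β + 1) (by linarith)).ne'
    have f2 : (i.factorial : ℝ) ≠ 0 := by exact_mod_cast i.factorial_ne_zero
    have f3 : (l.factorial : ℝ) ≠ 0 := by exact_mod_cast l.factorial_ne_zero
    have f4 : (l : ℝ) + 1 ≠ 0 := by positivity
    rw [show i + l + 1 - i = l + 1 by omega, show i + l - i = l by omega,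
      show i + l + 1 + i = i + l + i + 1 by omega, ascPochhammer_succ_eval, Nat.factorial_succ,
      pow_succ]
    push_cast
    field_simp
    ring
  · rw [show n + 1 + (n + 1) = n + (n + 1) + 1 by omega,
      ascPochhammer_succ_eval (n + (n + 1)) (α + β + 2)]
    push_cast
    ring

theorem sum_jacobiZ {α β : ℝ} (hα : -1 < α) (hβ : -1 < β) (n : ℕ) (t : ℝ) :
    ∑ k ∈ Finset.range (n + 1), jacobiZ α β k t = jacobiSum α β n ((t + 1) / 2) := by
  induction n with
  | zero => simp [jacobiZ_zero]
  | succ n ih => rw [Finset.sum_range_succ, ih, jacobiZ_succ hα hβ]; ring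

/-! ### Cesàro sums, and comparison of Jacobi with Gegenbauer coefficients -/

/-- Composition law for Cesàro sums: sums of order `a + b` are weighted sums of those of order
`b`. -/
theorem sum_risingCoeff_add_mul (a b : ℝ) (g : ℕ → ℝ) (n : ℕ) :
    ∑ k ∈ Finset.range (n + 1), risingCoeff (a + b) (n - k) * g k =
      ∑ j ∈ Finset.range (n + 1), risingCoeff a (n - j) *
        ∑ k ∈ Finset.range (j + 1), risingCoeff b (j - k) * g k := by
  open PowerSeries in
  have h1 : ∀ (c : ℝ) (h : ℝ⟦X⟧) (m : ℕ), coeff m (geomPow c 1 * h) =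
      ∑ k ∈ Finset.range (m + 1), risingCoeff c (m - k) * coeff k h := by
    intro c h m
    rw [mul_comm, coeff_mul, Finset.Nat.sum_antidiagonal_eq_sum_range_succ
      (fun i j => coeff i h * coeff j (geomPow c 1))]
    refine Finset.sum_congr rfl fun k _ => ?_
    simp [geomPow, mul_comm]
  open PowerSeries in
  have h2 := congrArg (fun q => coeff n (q * PowerSeries.mk g)) (geomPow_mul_geomPow a b (1 : ℝ))
  simp only [mul_assoc, h1, PowerSeries.coeff_mk] at h2
  exact h2.symm

/-- The even Gegenbauer polynomial `C_{2j}^{(s)}`. -/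
def gegenbauerEven (s : ℝ) (j : ℕ) (y : ℝ) : ℝ :=
  ∑ i ∈ Finset.range (j + 1),
    risingCoeff s (j + i) * ((j + i).choose (j - i) : ℝ) * (-1) ^ (j - i) * (2 * y) ^ (2 * i)

theorem eval_ascPochhammer_half (i : ℕ) :
    ((2 * i).factorial : ℝ) = 4 ^ i * i.factorial * (ascPochhammer ℝ i).eval (1 / 2) := by
  induction i with
  | zero => simp
  | succ i ih =>
    rw [show 2 * (i + 1) = 2 * i + 1 + 1 by ring, Nat.factorial_succ, Nat.factorial_succ,
      Nat.factorial_succ, ascPochhammer_succ_eval]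
    push_cast
    rw [ih]
    ring

/-- Since (2i)! = 4^i i! (1/2)_i, a Gegenbauer coefficient times the moment (1/2)_i / (b)_i is a
coefficient of the Jacobi partial sum, up to the sign. This is the algebra behind
`jacobiSum_eq_integral`. -/
theorem jacobiSum_coeff (s b : ℝ) {i j : ℕ} (h : i ≤ j) :
    risingCoeff s (j + i) * ((j + i).choose (j - i) : ℝ) * 4 ^ i *
      ((ascPochhammer ℝ i).eval (1 / 2) / (ascPochhammer ℝ i).eval b) =
    (ascPochhammer ℝ (j + i)).eval s /
      ((j - i).factorial * i.factorial * (ascPochhammer ℝ i).eval b) := by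
  obtain ⟨l, rfl⟩ := Nat.exists_eq_add_of_le h
  have hc := Nat.add_choose_mul_factorial_mul_factorial l (2 * i)
  have hc' : (((i + l + i).choose l : ℕ) : ℝ) * l.factorial * (2 * i).factorial =
      (i + l + i).factorial := by
    rw [show i + l + i = l + 2 * i by ring, Nat.choose_symm_add]; exact_mod_cast hc
  have h2 := eval_ascPochhammer_half i
  have f1 : ((i + l + i).factorial : ℝ) ≠ 0 := by exact_mod_cast Nat.factorial_ne_zero _
  have f2 : (i.factorial : ℝ) ≠ 0 := by exact_mod_cast i.factorial_ne_zero
  have f3 : (l.factorial : ℝ) ≠ 0 := by exact_mod_cast l.factorial_ne_zero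
  rw [show i + l - i = l by omega, risingCoeff]
  rcases eq_or_ne ((ascPochhammer ℝ i).eval b) 0 with h0 | h0
  -- Both sides vanish by the convention for division by zero.
  · simp [h0]
  rw [h2] at hc'
  field_simp
  rw [← hc']; ring

/-! ### Coefficients of products of binomial series -/

/-- `P` converges to `f` on the open unit disc. -/
def ConvergesTo (P : PowerSeries ℂ) (f : ℂ → ℂ) : Prop :=
  ∀ z : ℂ, ‖z‖ < 1 → HasSum (fun n => PowerSeries.coeff n P * z ^ n) (f z)

theorem ConvergesTo.mul {P Q : PowerSeries ℂ} {f g : ℂ → ℂ} (hP : ConvergesTo P f)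
    (hQ : ConvergesTo Q g) : ConvergesTo (P * Q) (fun z => f z * g z) := by
  intro z hz
  have h1 := (summable_norm_iff.mpr (hP z hz).summable)
  have h2 := (summable_norm_iff.mpr (hQ z hz).summable)
  have h3 := tsum_mul_tsum_eq_tsum_sum_antidiagonal_of_summable_norm h1 h2
  have h4 := (summable_norm_sum_mul_antidiagonal_of_summable_norm h1 h2).of_norm.hasSum
  rw [← h3, (hP z hz).tsum_eq, (hQ z hz).tsum_eq] at h4
  refine h4.congr_fun fun n => ?_
  rw [PowerSeries.coeff_mul, Finset.sum_mul]
  refine Finset.sum_congr rfl fun p hp => ?_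
  rw [← Finset.HasAntidiagonal.mem_antidiagonal.mp hp, pow_add]; ring

theorem convergesTo_geomPow (s : ℝ) {ζ : ℂ} (hζ : ‖ζ‖ = 1) :
    ConvergesTo (geomPow (s : ℂ) ζ) (fun z => 1 / (1 - ζ * z) ^ (s : ℂ)) := by
  intro z hz
  have h := Complex.one_div_one_sub_cpow_hasFPowerSeriesOnBall_zero (s : ℂ)
  have hmem : ζ * z ∈ Metric.eball (0 : ℂ) 1 := by
    rw [Metric.mem_eball, edist_zero_right]
    have : ‖ζ * z‖ < 1 := by rw [norm_mul, hζ, one_mul]; exact hz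
    rw [← ofReal_norm, ENNReal.ofReal_lt_one]
    exact this
  have h2 := h.hasSum hmem
  rw [zero_add] at h2
  refine h2.congr_fun fun n => ?_
  rw [FormalMultilinearSeries.ofScalars_apply_eq, choose_eq_risingCoeff, geomPow,
    PowerSeries.coeff_mk, smul_eq_mul, mul_pow]
  ring

/-- Cauchy's estimate in mean form. The mean of |f|, rather than its maximum, is essential: it saves
one power of the distance to the unit circle. -/
theorem ConvergesTo.norm_coeff_le {P : PowerSeries ℂ} {f : ℂ → ℂ} (hP : ConvergesTo P f)
    {ρ : ℝ} (h0 : 0 < ρ) (h1 : ρ < 1) (n : ℕ) :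
    ‖PowerSeries.coeff n P‖ * ρ ^ n ≤
      (2 * Real.pi)⁻¹ * ∫ θ in (0 : ℝ)..2 * Real.pi, ‖f (circleMap 0 ρ θ)‖ := by
  have hball : HasFPowerSeriesOnBall f
      (FormalMultilinearSeries.ofScalars ℂ fun n => PowerSeries.coeff n P) 0 1 := by
    refine HasFPowerSeriesOnBall.mk ?_ one_pos ?_
    · refine ENNReal.le_of_forall_nnreal_lt fun r hr => ?_
      apply FormalMultilinearSeries.le_radius_of_summable_norm
      have hr' : ‖((r : ℝ) : ℂ)‖ < 1 := by
        rw [Complex.norm_real, NNReal.norm_eq]; exact_mod_cast hr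
      refine (summable_norm_iff.mpr (hP _ hr').summable).congr fun n => ?_
      rw [FormalMultilinearSeries.ofScalars_norm, norm_mul, norm_pow, Complex.norm_real,
        NNReal.norm_eq]
    · intro y hy
      have hy' : ‖y‖ < 1 := by
        rw [Metric.mem_eball, edist_zero_right, ← ofReal_norm, ENNReal.ofReal_lt_one] at hy
        exact hy
      rw [zero_add]
      simpa only [FormalMultilinearSeries.ofScalars_apply_eq, smul_eq_mul] using hP y hy'
  have hd : DifferentiableOn ℂ f (Metric.closedBall 0 (⟨ρ, h0.le⟩ : NNReal)) := by
    refine hball.differentiableOn.mono fun y hy => ?_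
    rw [Metric.mem_eball, edist_zero_right, ← ofReal_norm, ENNReal.ofReal_lt_one]
    rw [mem_closedBall_zero_iff] at hy
    exact lt_of_le_of_lt hy h1
  have hc := hd.hasFPowerSeriesOnBall (by exact_mod_cast h0)
  have heq := hball.hasFPowerSeriesAt.eq_formalMultilinearSeries hc.hasFPowerSeriesAt
  have hn := norm_cauchyPowerSeries_le f 0 ρ n
  have hn2 : ‖PowerSeries.coeff n P‖ = ‖cauchyPowerSeries f 0 ρ n‖ := by
    have := congrArg (fun p => ‖p n‖) heq
    simp only [FormalMultilinearSeries.ofScalars_norm] at this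
    exact this
  rw [← hn2, abs_of_pos h0, inv_pow, ← div_eq_mul_inv, le_div_iff₀ (pow_pos h0 n)] at hn
  exact hn

/-! ### Distances to the four singular points -/

/-- Split M^(-2d) as M^(-η) M^(-(2d-η)); the first factor is handed to the smallest distance m, the
second is estimated through v. -/
theorem rpow_neg_prod_le {m M v p d η : ℝ} (hm : 0 < m) (hmM : m ≤ M) (hv : 0 < v) (hvM : v ≤ M)
    (hp : m * M ^ 2 ≤ p) (hd : 0 ≤ d) (hη : 0 ≤ η) (hηd : η ≤ 2 * d) :
    p ^ (-d) ≤ v ^ (-(2 * d - η)) * m ^ (-(d + η)) := by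
  have hM : 0 < M := hm.trans_le hmM
  calc p ^ (-d) ≤ (m * M ^ 2) ^ (-d) :=
        Real.rpow_le_rpow_of_nonpos (by positivity) hp (by linarith)
    _ = m ^ (-d) * (M ^ (-η) * M ^ (-(2 * d - η))) := by
        rw [Real.mul_rpow hm.le (by positivity), ← Real.rpow_natCast, ← Real.rpow_mul hM.le,
          ← Real.rpow_add hM]
        congr 2; push_cast; ring
    _ ≤ m ^ (-d) * (m ^ (-η) * v ^ (-(2 * d - η))) := by
        have h1 := Real.rpow_le_rpow_of_nonpos hm hmM (by linarith : -η ≤ 0)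
        have h2 := Real.rpow_le_rpow_of_nonpos hv hvM (by linarith : -(2 * d - η) ≤ 0)
        exact mul_le_mul_of_nonneg_left (mul_le_mul h1 h2 (by positivity) (by positivity))
          (by positivity)
    _ = v ^ (-(2 * d - η)) * m ^ (-(d + η)) := by
        rw [neg_add, Real.rpow_add hm]; ring

/-- Let m be the smallest distance. The larger of a and b is at least 1 because a + b ≥ 2. Each of
the remaining two is at least m and, its sum with m being at least s, also at least s/2. So the
product is at least m · max(m, s/2)². The sum of four powers on the right covers every choice of m.
-/
theorem rpow_neg_four_le {a b c e s ε d η : ℝ} (hε : 0 < ε) (ha : ε ≤ a) (hb : ε ≤ b)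
    (hc : ε ≤ c) (he : ε ≤ e) (hs : 0 ≤ s) (hab : 2 ≤ a + b) (hac : s ≤ a + c) (hae : s ≤ a + e)
    (hbc : s ≤ b + c) (hbe : s ≤ b + e) (hce : s ≤ c + e)
    (hd : 0 ≤ d) (hη : 0 ≤ η) (hηd : η ≤ 2 * d) :
    (a * b * c * e) ^ (-d) ≤ ((ε + s) / 4) ^ (-(2 * d - η)) *
      (a ^ (-(d + η)) + b ^ (-(d + η)) + c ^ (-(d + η)) + e ^ (-(d + η))) := by
  have ha0 := hε.trans_le ha
  have hb0 := hε.trans_le hb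
  have hc0 := hε.trans_le hc
  have he0 := hε.trans_le he
  have key : ∀ m x y z : ℝ, ε ≤ m → 1 ≤ x → m ≤ y → m ≤ z → s / 2 ≤ y → s / 2 ≤ z →
      a * b * c * e = m * (x * y * z) →
      m ^ (-(d + η)) ≤ a ^ (-(d + η)) + b ^ (-(d + η)) + c ^ (-(d + η)) + e ^ (-(d + η)) →
      (a * b * c * e) ^ (-d) ≤ ((ε + s) / 4) ^ (-(2 * d - η)) *
      (a ^ (-(d + η)) + b ^ (-(d + η)) + c ^ (-(d + η)) + e ^ (-(d + η))) := by
    intro m x y z hm hx hy hz hy' hz' hprod hle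
    have hm0 := hε.trans_le hm
    have hMy : max m (s / 2) ≤ y := max_le hy hy'
    have hMz : max m (s / 2) ≤ z := max_le hz hz'
    have hM0 : 0 ≤ max m (s / 2) := hm0.le.trans (le_max_left _ _)
    refine (rpow_neg_prod_le (M := max m (s / 2)) (v := (ε + s) / 4) hm0 (le_max_left _ _)
      (by positivity) ?_ ?_ hd hη hηd).trans ?_
    · have h1 := le_max_left m (s / 2)
      have h2 := le_max_right m (s / 2)
      linarith
    · rw [hprod]
      refine mul_le_mul_of_nonneg_left ?_ hm0.le
      calc max m (s / 2) ^ 2 = 1 * max m (s / 2) * max m (s / 2) := by ring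
        _ ≤ x * y * z :=
          mul_le_mul (mul_le_mul hx hMy hM0 (by linarith)) hMz hM0 (by nlinarith)
    · exact mul_le_mul_of_nonneg_left hle (by positivity)
  have pa : 0 ≤ a ^ (-(d + η)) := by positivity
  have pb : 0 ≤ b ^ (-(d + η)) := by positivity
  have pc : 0 ≤ c ^ (-(d + η)) := by positivity
  have pe : 0 ≤ e ^ (-(d + η)) := by positivity
  rcases le_total a b with h1 | h1 <;> rcases le_total c e with h2 | h2
  · rcases le_total a c with h3 | h3
    · exact key a b c e ha (by linarith) (by linarith) (by linarith) (by linarith) (by linarith)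
        (by ring) (by linarith)
    · exact key c b a e hc (by linarith) (by linarith) (by linarith) (by linarith) (by linarith)
        (by ring) (by linarith)
  · rcases le_total a e with h3 | h3
    · exact key a b c e ha (by linarith) (by linarith) (by linarith) (by linarith) (by linarith)
        (by ring) (by linarith)
    · exact key e b a c he (by linarith) (by linarith) (by linarith) (by linarith) (by linarith)
        (by ring) (by linarith)
  · rcases le_total b c with h3 | h3
    · exact key b a c e hb (by linarith) (by linarith) (by linarith) (by linarith) (by linarith)
        (by ring) (by linarith)
    · exact key c a b e hc (by linarith) (by linarith) (by linarith) (by linarith) (by linarith)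
        (by ring) (by linarith)
  · rcases le_total b e with h3 | h3
    · exact key b a c e hb (by linarith) (by linarith) (by linarith) (by linarith) (by linarith)
        (by ring) (by linarith)
    · exact key e a b c he (by linarith) (by linarith) (by linarith) (by linarith) (by linarith)
        (by ring) (by linarith)

/-! ### Integral means of negative powers on a circle -/

theorem norm_one_sub_ge {ρ φ : ℝ} (hρ : 1 / 2 ≤ ρ) (hρ1 : ρ < 1) (hφ : |φ| ≤ Real.pi) :
    ((1 - ρ) + |φ|) / 4 ≤ ‖1 - ρ * Complex.exp (φ * Complex.I)‖ := by
  have hcos := Real.cos_le_one_sub_mul_cos_sq hφ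
  have hsq : ‖1 - ρ * Complex.exp (φ * Complex.I)‖ ^ 2 = (1 - ρ) ^ 2 + 2 * ρ * (1 - Real.cos φ) := by
    rw [← Complex.normSq_eq_norm_sq, Complex.normSq_apply, Complex.exp_mul_I,
      ← Complex.ofReal_cos, ← Complex.ofReal_sin]
    simp only [Complex.sub_re, Complex.sub_im, Complex.mul_re, Complex.mul_im, Complex.add_re,
      Complex.add_im, Complex.ofReal_re, Complex.ofReal_im, Complex.I_re, Complex.I_im,
      Complex.one_re, Complex.one_im]
    linear_combination ρ ^ 2 * Real.sin_sq_add_cos_sq φ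
  -- This is π² ≤ 10.
  have hpi : (1 : ℝ) / 5 ≤ 2 / Real.pi ^ 2 := by
    rw [div_le_div_iff₀ (by norm_num) (by positivity)]
    nlinarith [Real.pi_lt_d2, Real.pi_pos]
  have hφ2 : 1 / 5 * φ ^ 2 ≤ 1 - Real.cos φ := by nlinarith [sq_nonneg φ]
  refine le_of_sq_le_sq ?_ (norm_nonneg _)
  rw [hsq]
  nlinarith [sq_abs φ, sq_nonneg ((1 - ρ) - |φ|), sq_nonneg φ, sq_nonneg (1 - ρ)]

theorem integral_add_rpow_neg_le {κ ε b : ℝ} (hκ : 1 < κ) (hε : 0 < ε) (hb : 0 ≤ b) :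
    ∫ φ in (0 : ℝ)..b, (ε + φ) ^ (-κ) ≤ ε ^ (1 - κ) / (κ - 1) := by
  rw [intervalIntegral.integral_comp_add_left (fun x => x ^ (-κ)), add_zero, integral_rpow]
  · have h1 : 0 ≤ (ε + b) ^ (1 - κ) := by positivity
    rw [show -κ + 1 = 1 - κ by ring, ← neg_div_neg_eq, neg_sub, neg_sub]
    gcongr
    · linarith
  · right
    refine ⟨by linarith, ?_⟩
    rw [Set.uIcc_of_le (by linarith)]
    intro h
    linarith [h.1]

/-- By periodicity the singular point can be rotated to 1; there the distance is comparable to (1 -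
ρ) + |φ|, and κ > 1 makes the integral of its negative power of order (1 - ρ)^(1-κ). -/
theorem integral_norm_one_sub_rpow_neg_le {κ ρ : ℝ} (hκ : 1 < κ) (hρ : 1 / 2 ≤ ρ) (hρ1 : ρ < 1)
    (ψ : ℝ) :
    ∫ θ in (0 : ℝ)..2 * Real.pi,
      ‖1 - Complex.exp (ψ * Complex.I) * circleMap 0 ρ θ‖ ^ (-κ) ≤
      2 * 4 ^ κ / (κ - 1) * (1 - ρ) ^ (1 - κ) := by
  set g : ℝ → ℝ := fun φ => ‖1 - ρ * Complex.exp (φ * Complex.I)‖ ^ (-κ) with hg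
  have hε : 0 < 1 - ρ := by linarith
  have hne : ∀ φ : ℝ, ‖1 - ρ * Complex.exp (φ * Complex.I)‖ ≠ 0 := by
    intro φ h
    rw [norm_eq_zero, sub_eq_zero] at h
    have := congrArg norm h
    rw [norm_mul, Complex.norm_exp_ofReal_mul_I, Complex.norm_real, norm_one, mul_one,
      Real.norm_of_nonneg (by linarith)] at this
    linarith
  have hgc : Continuous g := by
    refine Continuous.rpow_const (by fun_prop) fun φ => Or.inl (hne φ)
  have hper : Function.Periodic g (2 * Real.pi) := by
    intro φ
    simp only [hg]
    have : Complex.exp (((φ + 2 * Real.pi : ℝ) : ℂ) * Complex.I) = Complex.exp (φ * Complex.I) := by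
      push_cast
      rw [add_mul, Complex.exp_add, Complex.exp_two_pi_mul_I, mul_one]
    rw [this]
  have h1 : ∫ θ in (0 : ℝ)..2 * Real.pi,
      ‖1 - Complex.exp (ψ * Complex.I) * circleMap 0 ρ θ‖ ^ (-κ) =
      ∫ θ in (0 : ℝ)..2 * Real.pi, g (θ + ψ) := by
    refine intervalIntegral.integral_congr fun θ _ => ?_
    simp only [hg, circleMap_zero]
    congr 3
    push_cast
    rw [add_mul, Complex.exp_add]; ring
  have h2 : ∫ θ in (0 : ℝ)..2 * Real.pi, g (θ + ψ) = ∫ θ in -Real.pi..Real.pi, g θ := by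
    rw [intervalIntegral.integral_comp_add_right, zero_add,
      show 2 * Real.pi + ψ = ψ + 2 * Real.pi by ring, hper.intervalIntegral_add_eq ψ (-Real.pi)]
    congr 1; ring
  have hbound : ∀ φ : ℝ, |φ| ≤ Real.pi → g φ ≤ 4 ^ κ * ((1 - ρ) + |φ|) ^ (-κ) := by
    intro φ hφ
    have h := norm_one_sub_ge hρ hρ1 hφ
    have h0 : 0 < (1 - ρ) + |φ| := by positivity
    calc g φ ≤ (((1 - ρ) + |φ|) / 4) ^ (-κ) :=
          Real.rpow_le_rpow_of_nonpos (by positivity) h (by linarith)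
      _ = 4 ^ κ * ((1 - ρ) + |φ|) ^ (-κ) := by
          rw [Real.div_rpow h0.le (by norm_num), Real.rpow_neg (by norm_num : (0 : ℝ) ≤ 4),
            div_inv_eq_mul, mul_comm]
  have hhalf : ∀ h : ℝ → ℝ, Continuous h →
      (∀ φ ∈ Set.Icc 0 Real.pi, h φ ≤ 4 ^ κ * ((1 - ρ) + φ) ^ (-κ)) →
      ∫ φ in (0 : ℝ)..Real.pi, h φ ≤ 4 ^ κ / (κ - 1) * (1 - ρ) ^ (1 - κ) := by
    intro h hc hle
    calc ∫ φ in (0 : ℝ)..Real.pi, h φ ≤ ∫ φ in (0 : ℝ)..Real.pi, 4 ^ κ * ((1 - ρ) + φ) ^ (-κ) := by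
          refine intervalIntegral.integral_mono_on Real.pi_pos.le (hc.intervalIntegrable _ _) ?_ hle
          refine ContinuousOn.intervalIntegrable ?_
          refine ContinuousOn.mul continuousOn_const (ContinuousOn.rpow_const (by fun_prop) ?_)
          intro x hx
          rw [Set.uIcc_of_le Real.pi_pos.le] at hx
          left; linarith [hx.1]
      _ ≤ 4 ^ κ * ((1 - ρ) ^ (1 - κ) / (κ - 1)) := by
          rw [intervalIntegral.integral_const_mul]
          gcongr
          exact integral_add_rpow_neg_le hκ hε Real.pi_pos.le
      _ = _ := by ring
  have h3 : ∫ θ in -Real.pi..Real.pi, g θ =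
      (∫ θ in (0 : ℝ)..Real.pi, g (-θ)) + ∫ θ in (0 : ℝ)..Real.pi, g θ := by
    rw [← intervalIntegral.integral_add_adjacent_intervals
      (hgc.intervalIntegrable (-Real.pi) 0) (hgc.intervalIntegrable 0 Real.pi)]
    congr 1
    have := intervalIntegral.integral_comp_neg (a := 0) (b := Real.pi) g
    rw [this, neg_zero]
  rw [h1, h2, h3]
  have e1 := hhalf (fun θ => g (-θ)) (hgc.comp continuous_neg) (by
    intro φ hφ
    have := hbound (-φ) (by rw [abs_neg, abs_of_nonneg hφ.1]; exact hφ.2)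
    rwa [abs_neg, abs_of_nonneg hφ.1] at this)
  have e2 := hhalf g hgc (by
    intro φ hφ
    have := hbound φ (by rw [abs_of_nonneg hφ.1]; exact hφ.2)
    rwa [abs_of_nonneg hφ.1] at this)
  calc _ ≤ 4 ^ κ / (κ - 1) * (1 - ρ) ^ (1 - κ) + 4 ^ κ / (κ - 1) * (1 - ρ) ^ (1 - κ) :=
        add_le_add e1 e2
    _ = _ := by ring

/-! ### The coefficient bound from the four singular points -/

/-- The coefficient of `r ^ (2n)` in `((1 - r²) (1 - 2 r y + r²)) ^ (-s)`. -/
def cesaroGegenbauer (s : ℝ) (n : ℕ) (y : ℝ) : ℝ :=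
  ∑ j ∈ Finset.range (n + 1), risingCoeff s (n - j) * gegenbauerEven s j y

theorem coeff_even_mul {P Q : PowerSeries ℂ}
    (hP : ∀ n, PowerSeries.coeff n P = if 2 ∣ n then PowerSeries.coeff n P else 0) (n : ℕ) :
    PowerSeries.coeff (2 * n) (P * Q) = ∑ p ∈ Finset.HasAntidiagonal.antidiagonal n,
      PowerSeries.coeff (2 * p.1) P * PowerSeries.coeff (2 * p.2) Q := by
  rw [PowerSeries.coeff_mul]
  symm
  refine Finset.sum_of_injOn (fun p => (2 * p.1, 2 * p.2)) ?_ ?_ ?_ ?_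
  · intro p _ q _ h
    simp only [Prod.mk.injEq] at h
    ext <;> omega
  · intro p hp
    simp only [Finset.mem_coe, Finset.HasAntidiagonal.mem_antidiagonal] at hp ⊢
    omega
  · rintro ⟨a, b⟩ hp hp'
    rw [hP, if_neg, zero_mul]
    rintro ⟨k, hk⟩
    simp only at hk
    rw [Finset.HasAntidiagonal.mem_antidiagonal] at hp
    simp only at hp
    refine hp' ⟨(k, n - k), ?_, ?_⟩
    · simp only [Finset.mem_coe, Finset.HasAntidiagonal.mem_antidiagonal]; omega
    · simp only [Prod.mk.injEq]; omega
  · intro p _; rfl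

/-- Multiply the factors in pairs: (1 - X)(1 + X) = 1 - X² and (1 - exp(iψ)X)(1 - exp(-iψ)X) = 1 - 2
cos ψ X + X². The first pair contributes only even powers. -/
theorem ofReal_cesaroGegenbauer (s : ℝ) (n : ℕ) (ψ : ℝ) :
    ((cesaroGegenbauer s n (Real.cos ψ) : ℝ) : ℂ) = PowerSeries.coeff (2 * n)
      ((geomPow (s : ℂ) 1 * geomPow (s : ℂ) (-1)) *
        (geomPow (s : ℂ) (Complex.exp (ψ * Complex.I)) *
          geomPow (s : ℂ) (Complex.exp ((-ψ : ℝ) * Complex.I)))) := by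
  have h1 : Complex.exp (ψ * Complex.I) * Complex.exp ((-ψ : ℝ) * Complex.I) = 1 := by
    rw [← Complex.exp_add]; push_cast; simp
  have h2 : Complex.exp (ψ * Complex.I) + Complex.exp ((-ψ : ℝ) * Complex.I) =
      2 * Complex.cos ψ := by
    rw [Complex.two_cos]; push_cast; simp
  rw [geomPow_mul_eq_quadPow, geomPow_mul_eq_quadPow, h1, h2, show (1 : ℂ) + -1 = 0 by ring,
    show (1 : ℂ) * -1 = -1 by ring, coeff_even_mul (by
      intro m
      rw [coeff_quadPow_zero_neg_one]
      split_ifs <;> rfl), cesaroGegenbauer,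
    ← Finset.Nat.sum_antidiagonal_swap,
    Finset.Nat.sum_antidiagonal_eq_sum_range_succ_mk]
  push_cast
  refine Finset.sum_congr rfl fun j _ => ?_
  simp only [Prod.fst_swap, Prod.snd_swap]
  rw [coeff_quadPow_zero_neg_one, if_pos ⟨_, rfl⟩, Nat.mul_div_cancel_left _ two_pos,
    coeff_quadPow_even, gegenbauerEven, ofReal_risingCoeff]
  congr 1
  push_cast
  refine Finset.sum_congr rfl fun i _ => ?_
  rw [ofReal_risingCoeff]

theorem norm_sub_le_of_norm_eq_one {ζ ξ : ℂ} (hζ : ‖ζ‖ = 1) (hξ : ‖ξ‖ = 1) (z : ℂ) :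
    ‖ζ - ξ‖ ≤ ‖1 - ζ * z‖ + ‖1 - ξ * z‖ := by
  calc ‖ζ - ξ‖ = ‖ζ * (1 - ξ * z) - ξ * (1 - ζ * z)‖ := by congr 1; ring
    _ ≤ ‖ζ * (1 - ξ * z)‖ + ‖ξ * (1 - ζ * z)‖ := norm_sub_le _ _
    _ = _ := by rw [norm_mul, norm_mul, hζ, hξ]; ring

theorem one_sub_norm_le {ζ : ℂ} (hζ : ‖ζ‖ = 1) (z : ℂ) : 1 - ‖z‖ ≤ ‖1 - ζ * z‖ := by
  have := norm_sub_norm_le 1 (ζ * z)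
  rwa [norm_one, norm_mul, hζ, one_mul] at this

theorem norm_inv_cpow_four_le {d η ρ ψ θ : ℝ} (hd : 0 ≤ d) (hη : 0 ≤ η) (hηd : η ≤ 2 * d)
    (h0 : 0 < ρ) (h1 : ρ < 1) :
    ‖(1 / (1 - 1 * circleMap 0 ρ θ) ^ (d : ℂ) * (1 / (1 - -1 * circleMap 0 ρ θ) ^ (d : ℂ))) *
      (1 / (1 - Complex.exp (ψ * Complex.I) * circleMap 0 ρ θ) ^ (d : ℂ) *
        (1 / (1 - Complex.exp ((-ψ : ℝ) * Complex.I) * circleMap 0 ρ θ) ^ (d : ℂ)))‖ ≤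
      ((1 - ρ + |Real.sin ψ|) / 4) ^ (-(2 * d - η)) *
      (‖1 - Complex.exp ((0 : ℝ) * Complex.I) * circleMap 0 ρ θ‖ ^ (-(d + η)) +
       ‖1 - Complex.exp (Real.pi * Complex.I) * circleMap 0 ρ θ‖ ^ (-(d + η)) +
       ‖1 - Complex.exp (ψ * Complex.I) * circleMap 0 ρ θ‖ ^ (-(d + η)) +
       ‖1 - Complex.exp ((-ψ : ℝ) * Complex.I) * circleMap 0 ρ θ‖ ^ (-(d + η))) := by
  have hz : ‖circleMap 0 ρ θ‖ = ρ := by rw [norm_circleMap_zero, abs_of_pos h0]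
  generalize circleMap 0 ρ θ = z at hz
  have hexp0 : Complex.exp ((0 : ℝ) * Complex.I) = 1 := by simp
  rw [hexp0, Complex.exp_pi_mul_I]
  have n1 : ‖(1 : ℂ)‖ = 1 := norm_one
  have n2 : ‖(-1 : ℂ)‖ = 1 := by simp
  have n3 : ‖Complex.exp (ψ * Complex.I)‖ = 1 := Complex.norm_exp_ofReal_mul_I ψ
  have n4 : ‖Complex.exp ((-ψ : ℝ) * Complex.I)‖ = 1 := Complex.norm_exp_ofReal_mul_I (-ψ)
  have i3 : (Complex.exp (ψ * Complex.I)).im = Real.sin ψ := Complex.exp_ofReal_mul_I_im ψ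
  have i4 : (Complex.exp ((-ψ : ℝ) * Complex.I)).im = -Real.sin ψ := by
    rw [Complex.exp_ofReal_mul_I_im, Real.sin_neg]
  generalize Complex.exp (ψ * Complex.I) = u at n3 i3
  generalize Complex.exp ((-ψ : ℝ) * Complex.I) = v at n4 i4
  -- Imaginary parts separate exp(±iψ) from ±1, and from each other, by at least |sin ψ|.
  have him : ∀ ζ ξ : ℂ, ‖ζ‖ = 1 → ‖ξ‖ = 1 →
      |(ζ - ξ).im| ≤ ‖1 - ζ * z‖ + ‖1 - ξ * z‖ := fun ζ ξ hζ hξ =>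
    (Complex.abs_im_le_norm _).trans (norm_sub_le_of_norm_eq_one hζ hξ z)
  have hge : ∀ ζ : ℂ, ‖ζ‖ = 1 → 1 - ρ ≤ ‖1 - ζ * z‖ := fun ζ hζ => hz ▸ one_sub_norm_le hζ z
  have e12 := norm_sub_le_of_norm_eq_one n1 n2 z
  have e13 := him 1 u n1 n3
  have e14 := him 1 v n1 n4
  have e23 := him (-1) u n2 n3
  have e24 := him (-1) v n2 n4
  have e34 := him u v n3 n4
  rw [Complex.sub_im, i3] at e13 e23
  rw [Complex.sub_im, i4] at e14 e24
  rw [Complex.sub_im, i3, i4, sub_neg_eq_add, ← two_mul, abs_mul, abs_two] at e34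
  simp only [Complex.one_im, Complex.neg_im, neg_zero, zero_sub, sub_neg_eq_add, zero_add,
    abs_neg] at e13 e14 e23 e24
  have h12 : ‖(1 : ℂ) - -1‖ = 2 := by norm_num
  rw [h12] at e12
  have hs := abs_nonneg (Real.sin ψ)
  have hmain := rpow_neg_four_le (ε := 1 - ρ) (by linarith) (hge 1 n1) (hge (-1) n2) (hge u n3)
    (hge v n4) hs e12 e13 e14 e23 e24 (by linarith) hd hη hηd
  refine le_trans (le_of_eq ?_) hmain
  simp only [norm_mul, norm_div, norm_one, Complex.norm_cpow_real]
  rw [Real.mul_rpow (by positivity) (by positivity), Real.mul_rpow (by positivity) (by positivity),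
    Real.mul_rpow (by positivity) (by positivity), Real.rpow_neg (by positivity),
    Real.rpow_neg (by positivity), Real.rpow_neg (by positivity), Real.rpow_neg (by positivity)]
  simp only [one_div]
  ring

theorem abs_cesaroGegenbauer_cos_le {d η ρ : ℝ} (hd : 0 ≤ d) (hη : 0 ≤ η) (hηd : η ≤ 2 * d)
    (hdη : 1 < d + η) (h0 : 1 / 2 ≤ ρ) (h1 : ρ < 1) (n : ℕ) (ψ : ℝ) :
    |cesaroGegenbauer d n (Real.cos ψ)| * ρ ^ (2 * n) ≤
      (2 * Real.pi)⁻¹ * (((1 - ρ + |Real.sin ψ|) / 4) ^ (-(2 * d - η)) *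
        (4 * (2 * 4 ^ (d + η) / (d + η - 1) * (1 - ρ) ^ (1 - (d + η))))) := by
  have hρ0 : 0 < ρ := by linarith
  have hconv := ((convergesTo_geomPow d (ζ := 1) norm_one).mul
    (convergesTo_geomPow d (ζ := -1) (by simp))).mul
    ((convergesTo_geomPow d (Complex.norm_exp_ofReal_mul_I ψ)).mul
      (convergesTo_geomPow d (Complex.norm_exp_ofReal_mul_I (-ψ))))
  have h := hconv.norm_coeff_le hρ0 h1 (2 * n)
  rw [← ofReal_cesaroGegenbauer, Complex.norm_real, Real.norm_eq_abs] at h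
  refine h.trans (mul_le_mul_of_nonneg_left ?_ (by positivity))
  have hcont : ∀ φ : ℝ, Continuous fun θ : ℝ =>
      ‖1 - Complex.exp (φ * Complex.I) * circleMap 0 ρ θ‖ ^ (-(d + η)) := by
    intro φ
    have hcm : Continuous (circleMap 0 ρ) := continuous_circleMap 0 ρ
    refine Continuous.rpow_const (by fun_prop) fun θ => Or.inl ?_
    have := one_sub_norm_le (Complex.norm_exp_ofReal_mul_I φ) (circleMap 0 ρ θ)
    rw [norm_circleMap_zero, abs_of_pos hρ0] at this
    linarith
  have hint := fun φ : ℝ => (hcont φ).intervalIntegrable (μ := volume) 0 (2 * Real.pi)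
  have hI := fun φ : ℝ => integral_norm_one_sub_rpow_neg_le hdη h0 h1 φ
  refine (intervalIntegral.integral_mono_on_of_le_Ioo (by positivity) ?_
    (((((hint 0).add (hint Real.pi)).add (hint ψ)).add (hint (-ψ))).const_mul _)
    fun θ _ => norm_inv_cpow_four_le (θ := θ) (ψ := ψ) hd hη hηd hρ0 h1).trans ?_
  · refine Continuous.intervalIntegrable (continuous_norm.comp ?_) _ _
    have hc1 : ∀ ζ : ℂ, ‖ζ‖ = 1 → Continuous fun θ : ℝ =>
        1 / (1 - ζ * circleMap 0 ρ θ) ^ (d : ℂ) := by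
      intro ζ hζ
      have hcm : Continuous (circleMap 0 ρ) := continuous_circleMap 0 ρ
      have hslit : ∀ θ, 1 - ζ * circleMap 0 ρ θ ∈ Complex.slitPlane := by
        intro θ
        left
        have h3 := Complex.re_le_norm (ζ * circleMap 0 ρ θ)
        rw [norm_mul, hζ, norm_circleMap_zero, abs_of_pos hρ0] at h3
        rw [Complex.sub_re, Complex.one_re]; linarith
      refine continuous_const.div ?_ ?_
      · exact Continuous.cpow (by fun_prop) continuous_const hslit
      · intro θ hθ
        rw [Complex.cpow_eq_zero_iff] at hθ
        exact Complex.slitPlane_ne_zero (hslit θ) hθ.1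
    exact ((hc1 1 norm_one).mul (hc1 (-1) (by simp))).mul
      ((hc1 _ (Complex.norm_exp_ofReal_mul_I ψ)).mul (hc1 _ (Complex.norm_exp_ofReal_mul_I (-ψ))))
  · rw [intervalIntegral.integral_const_mul, intervalIntegral.integral_add
      (((hint 0).add (hint Real.pi)).add (hint ψ)) (hint (-ψ)),
      intervalIntegral.integral_add ((hint 0).add (hint Real.pi)) (hint ψ),
      intervalIntegral.integral_add (hint 0) (hint Real.pi)]
    have hsin := abs_nonneg (Real.sin ψ)
    refine mul_le_mul_of_nonneg_left ?_ (Real.rpow_nonneg (by linarith) _)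
    linarith [hI 0, hI Real.pi, hI ψ, hI (-ψ)]

theorem exists_abs_cesaroGegenbauer_le {d η : ℝ} (hd : 0 ≤ d) (hη : 0 ≤ η) (hηd : η ≤ 2 * d)
    (hdη : 1 < d + η) : ∃ C : ℝ, 0 < C ∧ ∀ (n : ℕ) (y : ℝ), y ^ 2 ≤ 1 →
      |cesaroGegenbauer d n y| ≤ C * ((n : ℝ) + 1) ^ (d + η - 1) *
        (1 / ((n : ℝ) + 1) ^ 2 + (1 - y ^ 2)) ^ (-(d - η / 2)) := by
  have hκ : 0 < d + η - 1 := by linarith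
  refine ⟨2 * ((2 * Real.pi)⁻¹ * ((1 / 256 : ℝ) ^ (-(d - η / 2)) *
    (4 * (2 * 4 ^ (d + η) / (d + η - 1) * 4 ^ (d + η - 1))))), by positivity, fun n y hy => ?_⟩
  have hN : (0 : ℝ) < (n : ℝ) + 1 := by positivity
  have hN1 : (1 : ℝ) ≤ (n : ℝ) + 1 := by linarith [(Nat.cast_nonneg n : (0 : ℝ) ≤ n)]
  -- This distance to the unit circle makes ρ^(2n) ≥ 1/2 by Bernoulli's inequality, so dividing by
  -- it costs only a factor 2.
  set ε : ℝ := 1 / (4 * ((n : ℝ) + 1)) with hε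
  have hε0 : 0 < ε := by positivity
  have hε4 : ε ≤ 1 / 4 := by
    rw [hε, div_le_div_iff₀ (by positivity) (by norm_num)]; linarith
  have habs := abs_le.mp ((sq_le_one_iff_abs_le_one y).mp hy)
  have h := abs_cesaroGegenbauer_cos_le (ρ := 1 - ε) hd hη hηd hdη (by linarith) (by linarith) n
    (Real.arccos y)
  rw [Real.cos_arccos habs.1 habs.2, Real.sin_arccos, abs_of_nonneg (Real.sqrt_nonneg _),
    sub_sub_cancel] at h
  set s : ℝ := √(1 - y ^ 2) with hs
  have hs0 : 0 ≤ s := Real.sqrt_nonneg _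
  have hs2 : s ^ 2 = 1 - y ^ 2 := Real.sq_sqrt (by linarith)
  have hpow : 1 / 2 ≤ (1 - ε) ^ (2 * n) := by
    have hb := one_add_mul_le_pow (a := -ε) (by linarith) (2 * n)
    have hεn : ε * (4 * ((n : ℝ) + 1)) = 1 := by rw [hε]; field_simp
    rw [← sub_eq_add_neg] at hb
    push_cast at hb
    nlinarith
  have hA : 0 < 1 / ((n : ℝ) + 1) ^ 2 + (1 - y ^ 2) := by
    have : 0 < 1 / ((n : ℝ) + 1) ^ 2 := by positivity
    linarith
  have h1 : ((ε + s) / 4) ^ (-(2 * d - η)) ≤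
      (1 / 256 : ℝ) ^ (-(d - η / 2)) *
        (1 / ((n : ℝ) + 1) ^ 2 + (1 - y ^ 2)) ^ (-(d - η / 2)) := by
    rw [← Real.mul_rpow (by norm_num) hA.le, show -(2 * d - η) = ((2 : ℕ) : ℝ) * (-(d - η / 2)) by
      push_cast; ring, Real.rpow_mul (by positivity), Real.rpow_natCast]
    refine Real.rpow_le_rpow_of_nonpos (by positivity) ?_ (by linarith)
    -- With 1/N² = 16ε², the claim is (16ε² + s²)/256 ≤ ((ε + s)/4)², which accounts for the 256.
    rw [← hs2, show 1 / ((n : ℝ) + 1) ^ 2 = (4 * ε) ^ 2 by rw [hε]; field_simp]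
    nlinarith [mul_nonneg hε0.le hs0, sq_nonneg s]
  have h2 : ε ^ (1 - (d + η)) = 4 ^ (d + η - 1) * ((n : ℝ) + 1) ^ (d + η - 1) := by
    rw [← Real.mul_rpow (by norm_num) hN.le, hε, one_div, Real.inv_rpow (by positivity),
      ← Real.rpow_neg (by positivity), neg_sub]
  rw [h2] at h
  have h3 : |cesaroGegenbauer d n y| ≤ 2 * (|cesaroGegenbauer d n y| * (1 - ε) ^ (2 * n)) := by
    nlinarith [abs_nonneg (cesaroGegenbauer d n y)]
  calc |cesaroGegenbauer d n y| ≤ 2 * (|cesaroGegenbauer d n y| * (1 - ε) ^ (2 * n)) := h3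
    _ ≤ 2 * ((2 * Real.pi)⁻¹ * (((ε + s) / 4) ^ (-(2 * d - η)) *
        (4 * (2 * 4 ^ (d + η) / (d + η - 1) * (4 ^ (d + η - 1) * ((n : ℝ) + 1) ^ (d + η - 1)))))) :=
      mul_le_mul_of_nonneg_left h two_pos.le
    _ ≤ 2 * ((2 * Real.pi)⁻¹ * ((1 / 256 : ℝ) ^ (-(d - η / 2)) *
        (1 / ((n : ℝ) + 1) ^ 2 + (1 - y ^ 2)) ^ (-(d - η / 2)) *
        (4 * (2 * 4 ^ (d + η) / (d + η - 1) *
          (4 ^ (d + η - 1) * ((n : ℝ) + 1) ^ (d + η - 1)))))) := by gcongr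
    _ = _ := by ring

/-- The binomial coefficient `C(n + d, n)` grows at least like `n ^ d`. -/
theorem rpow_le_risingCoeff {d : ℝ} (hd : 0 ≤ d) (n : ℕ) :
    (((n : ℝ) + 1) / (1 + d)) ^ d ≤ risingCoeff (d + 1) n := by
  -- The shift by d makes the induction close: with x = n + 1 + d, (1 + 1/x)^d ≤ exp(d/x) ≤ 1/(1 -
  -- d/x) = 1 + d/(n + 1), the exact ratio of consecutive coefficients.
  have key : (((n : ℝ) + 1 + d) / (1 + d)) ^ d ≤ risingCoeff (d + 1) n := by
    induction n with
    | zero =>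
      rw [Nat.cast_zero, zero_add, div_self (by linarith), Real.one_rpow, risingCoeff_zero]
    | succ n ih =>
      have hn : (0 : ℝ) ≤ n := Nat.cast_nonneg n
      have hrec := risingCoeff_succ (d + 1) n
      have hpos := risingCoeff_pos (s := d + 1) (by linarith) n
      have hx : 0 < (n : ℝ) + 1 + d := by linarith
      have h1 : (1 + 1 / ((n : ℝ) + 1 + d)) ^ d ≤ 1 + d / ((n : ℝ) + 1) := by
        calc (1 + 1 / ((n : ℝ) + 1 + d)) ^ d ≤ (Real.exp (1 / ((n : ℝ) + 1 + d))) ^ d := by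
              gcongr
              linarith [Real.add_one_le_exp (1 / ((n : ℝ) + 1 + d))]
          _ = (Real.exp (-(d / ((n : ℝ) + 1 + d))))⁻¹ := by
              rw [← Real.exp_mul, ← Real.exp_neg, neg_neg]; congr 1; ring
          _ ≤ (1 - d / ((n : ℝ) + 1 + d))⁻¹ := by
              have : 0 < 1 - d / ((n : ℝ) + 1 + d) := by
                rw [sub_pos, div_lt_one hx]; linarith
              gcongr
              linarith [Real.add_one_le_exp (-(d / ((n : ℝ) + 1 + d)))]
          _ = 1 + d / ((n : ℝ) + 1) := by
              have h2 : (n : ℝ) + 1 ≠ 0 := by positivity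
              have h3 := hx.ne'
              rw [show 1 - d / ((n : ℝ) + 1 + d) = ((n : ℝ) + 1) / ((n : ℝ) + 1 + d) by
                field_simp; ring, inv_div]
              field_simp
      have h4 : risingCoeff (d + 1) (n + 1) =
          risingCoeff (d + 1) n * (1 + d / ((n : ℝ) + 1)) := by
        have h2 : (n : ℝ) + 1 ≠ 0 := by positivity
        field_simp
        linear_combination hrec
      have h5 : (((n + 1 : ℕ) : ℝ) + 1 + d) / (1 + d) =
          (((n : ℝ) + 1 + d) / (1 + d)) * (1 + 1 / ((n : ℝ) + 1 + d)) := by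
        have h3 := hx.ne'
        push_cast
        field_simp
        ring
      rw [h4, h5, Real.mul_rpow (by positivity) (by positivity)]
      gcongr
  refine le_trans (Real.rpow_le_rpow (by positivity) ?_ hd) key
  exact div_le_div_of_nonneg_right (by linarith) (by linarith)

/-! ### The ultraspherical density `(1 - u²) ^ (p - 1)` on `[0, 1]` -/

theorem intervalIntegrable_one_sub_sq_rpow {p : ℝ} (hp : 0 < p) {g : ℝ → ℝ} (hg : Continuous g) :
    IntervalIntegrable (fun u => g u * (1 - u ^ 2) ^ (p - 1)) volume 0 1 := by
  have h1 : IntervalIntegrable (fun u : ℝ => (1 - u) ^ (p - 1)) volume 0 1 := by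
    have := (intervalIntegral.intervalIntegrable_rpow' (a := 1) (b := 0)
      (by linarith : -1 < p - 1)).comp_sub_left 1
    simpa using this
  have h2 : ContinuousOn (fun u : ℝ => g u * (1 + u) ^ (p - 1)) (Set.uIcc 0 1) := by
    refine hg.continuousOn.mul (ContinuousOn.rpow_const (by fun_prop) fun u hu => ?_)
    rw [Set.uIcc_of_le zero_le_one] at hu
    left; linarith [hu.1]
  refine (h1.continuousOn_mul h2).congr fun u hu => ?_
  rw [Set.uIoc_of_le zero_le_one] at hu
  have e : 1 - u ^ 2 = (1 + u) * (1 - u) := by ring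
  rw [e, Real.mul_rpow (by linarith [hu.1]) (by linarith [hu.2])]; ring

/-- Integrate the derivative of u^(2i+1) (1 - u²)^p, a function vanishing at both endpoints. -/
theorem integral_pow_mul_one_sub_sq_rpow_succ {p : ℝ} (hp : 0 < p) (i : ℕ) :
    ((i : ℝ) + 1 / 2 + p) * ∫ u in (0 : ℝ)..1, u ^ (2 * (i + 1)) * (1 - u ^ 2) ^ (p - 1) =
      ((i : ℝ) + 1 / 2) * ∫ u in (0 : ℝ)..1, u ^ (2 * i) * (1 - u ^ 2) ^ (p - 1) := by
  have hI : ∀ k : ℕ, IntervalIntegrable (fun u : ℝ => u ^ k * (1 - u ^ 2) ^ (p - 1)) volume 0 1 :=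
    fun k => intervalIntegrable_one_sub_sq_rpow hp (continuous_pow k)
  have hint := ((hI (2 * i)).const_mul (2 * (i : ℝ) + 1)).sub
    ((hI (2 * (i + 1))).const_mul (2 * (i : ℝ) + 1 + 2 * p))
  have key := intervalIntegral.integral_eq_sub_of_hasDerivAt_of_le zero_le_one
    (f := fun u : ℝ => u ^ (2 * i + 1) * (1 - u ^ 2) ^ p) (f' := fun u : ℝ =>
      (2 * (i : ℝ) + 1) * (u ^ (2 * i) * (1 - u ^ 2) ^ (p - 1)) -
      (2 * (i : ℝ) + 1 + 2 * p) * (u ^ (2 * (i + 1)) * (1 - u ^ 2) ^ (p - 1))) ?_ ?_ hint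
  · rw [intervalIntegral.integral_sub ((hI (2 * i)).const_mul _) ((hI (2 * (i + 1))).const_mul _),
      intervalIntegral.integral_const_mul, intervalIntegral.integral_const_mul] at key
    norm_num at key
    rw [Real.zero_rpow hp.ne'] at key
    linarith
  · exact (continuous_pow _).continuousOn.mul
      (ContinuousOn.rpow_const (by fun_prop) fun u _ => Or.inr hp.le)
  · intro u hu
    have hpos : 0 < 1 - u ^ 2 := by nlinarith [hu.1, hu.2]
    have h1 : HasDerivAt (fun u : ℝ => 1 - u ^ 2) (-(2 * u)) u := by
      simpa using (hasDerivAt_pow 2 u).const_sub 1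
    have h2 := (hasDerivAt_pow (2 * i + 1) u).mul (h1.rpow_const (p := p) (Or.inl hpos.ne'))
    refine h2.congr_deriv ?_
    have e : (1 - u ^ 2) ^ p = (1 - u ^ 2) ^ (p - 1) * (1 - u ^ 2) := by
      rw [← Real.rpow_add_one hpos.ne', sub_add_cancel]
    rw [e]
    push_cast
    ring

theorem integral_one_sub_sq_rpow_pos {p : ℝ} (hp : 0 < p) :
    0 < ∫ u in (0 : ℝ)..1, (1 - u ^ 2) ^ (p - 1) := by
  refine intervalIntegral.intervalIntegral_pos_of_pos_on ?_ (fun u hu => ?_) one_pos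
  · simpa using intervalIntegrable_one_sub_sq_rpow hp (g := fun _ => 1) continuous_const
  · exact Real.rpow_pos_of_pos (by nlinarith [hu.1, hu.2]) _

theorem integral_pow_mul_one_sub_sq_rpow {p : ℝ} (hp : 0 < p) (i : ℕ) :
    ∫ u in (0 : ℝ)..1, u ^ (2 * i) * (1 - u ^ 2) ^ (p - 1) =
      (∫ u in (0 : ℝ)..1, (1 - u ^ 2) ^ (p - 1)) *
        ((ascPochhammer ℝ i).eval (1 / 2) / (ascPochhammer ℝ i).eval (p + 1 / 2)) := by
  induction i with
  | zero => simp
  | succ i ih =>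
    have h := integral_pow_mul_one_sub_sq_rpow_succ hp i
    have h1 := (ascPochhammer_pos i (p + 1 / 2) (by linarith)).ne'
    have h2 : (i : ℝ) + 1 / 2 + p ≠ 0 := by positivity
    have h3 : p + 1 / 2 + (i : ℝ) ≠ 0 := by positivity
    apply mul_left_cancel₀ h2
    rw [h, ih, ascPochhammer_succ_eval, ascPochhammer_succ_eval]
    field_simp
    ring

/-- The integrand has the explicit antiderivative (v / (A + Xv))^p / (pA). -/
theorem integral_rpow_mul_add_rpow_neg_le {p A X : ℝ} (hp : 0 < p) (hA : 0 < A) (hX : 0 ≤ X)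
    (hAX : 1 ≤ A + X) :
    ∫ v in (0 : ℝ)..1, (A + X * v) ^ (-(p + 1)) * v ^ (p - 1) ≤ 1 / (p * A) := by
  have hpos : ∀ v : ℝ, 0 ≤ v → 0 < A + X * v := fun v hv => by positivity
  have hint : IntervalIntegrable (fun v : ℝ => p * A * ((A + X * v) ^ (-(p + 1)) * v ^ (p - 1)))
      volume 0 1 := by
    refine IntervalIntegrable.const_mul ?_ _
    refine (intervalIntegral.intervalIntegrable_rpow'
      (by linarith : -1 < p - 1)).continuousOn_mul ?_
    refine ContinuousOn.rpow_const (by fun_prop) fun v hv => Or.inl ?_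
    rw [Set.uIcc_of_le zero_le_one] at hv
    exact (hpos v hv.1).ne'
  have key := intervalIntegral.integral_eq_sub_of_hasDerivAt_of_le zero_le_one
    (f := fun v : ℝ => (v / (A + X * v)) ^ p) ?_ ?_ hint
  · rw [intervalIntegral.integral_const_mul] at key
    rw [le_div_iff₀ (by positivity), mul_comm, key]
    simp only [mul_one, zero_div, Real.zero_rpow hp.ne', sub_zero]
    refine Real.rpow_le_one (by positivity) ?_ hp.le
    rw [div_le_one (by linarith)]; exact hAX
  · refine ContinuousOn.rpow_const ?_ fun v _ => Or.inr hp.le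
    exact continuousOn_id.div (by fun_prop) fun v hv => (hpos v hv.1).ne'
  · intro v hv
    have h0 := hpos v hv.1.le
    have h1 : HasDerivAt (fun v : ℝ => A + X * v) X v := by
      simpa using ((hasDerivAt_id v).const_mul X).const_add A
    have h2 := ((hasDerivAt_id v).div h1 h0.ne').rpow_const (p := p)
      (Or.inl (div_pos hv.1 h0).ne')
    refine h2.congr_deriv ?_
    simp only [id, Pi.div_apply]
    rw [Real.div_rpow hv.1.le h0.le, Real.rpow_neg h0.le,
      show p + 1 = (p - 1) + ((2 : ℕ) : ℝ) by push_cast; ring, Real.rpow_add h0, Real.rpow_natCast]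
    have h3 := (Real.rpow_pos_of_pos h0 (p - 1)).ne'
    field_simp
    ring

/-- Replace 1 - u² by the smaller 1 - u in the negative power and give up all but p + 1 of the
exponent to A; the rest is integrated exactly. -/
theorem integral_add_rpow_neg_mul_one_sub_sq_rpow_le {p κ A X : ℝ} (hp : 0 < p)
    (hκ : p + 1 ≤ κ) (hA : 0 < A) (hX : 0 ≤ X) (hAX : 1 ≤ A + X) :
    ∫ u in (0 : ℝ)..1, (A + X * (1 - u ^ 2)) ^ (-κ) * (1 - u ^ 2) ^ (p - 1) ≤
      2 ^ p / p * A ^ (-(κ - p)) := by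
  have hpos : ∀ v : ℝ, 0 ≤ v → 0 < A + X * v := fun v hv => by positivity
  have hint : IntervalIntegrable (fun v : ℝ => (A + X * v) ^ (-(p + 1)) * v ^ (p - 1))
      volume 0 1 := by
    refine (intervalIntegral.intervalIntegrable_rpow'
      (by linarith : -1 < p - 1)).continuousOn_mul ?_
    refine ContinuousOn.rpow_const (by fun_prop) fun v hv => Or.inl ?_
    rw [Set.uIcc_of_le zero_le_one] at hv
    exact (hpos v hv.1).ne'
  have hint' : IntervalIntegrable (fun u : ℝ => 2 ^ p * A ^ (-(κ - p - 1)) *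
      ((A + X * (1 - u)) ^ (-(p + 1)) * (1 - u) ^ (p - 1))) volume 0 1 := by
    have := (hint.comp_sub_left 1).symm
    simp only [sub_zero, sub_self] at this
    exact this.const_mul _
  calc ∫ u in (0 : ℝ)..1, (A + X * (1 - u ^ 2)) ^ (-κ) * (1 - u ^ 2) ^ (p - 1)
      ≤ ∫ u in (0 : ℝ)..1, 2 ^ p * A ^ (-(κ - p - 1)) *
        ((A + X * (1 - u)) ^ (-(p + 1)) * (1 - u) ^ (p - 1)) := by
        refine intervalIntegral.integral_mono_on_of_le_Ioo zero_le_one ?_ hint' fun u hu => ?_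
        · have hI := intervalIntegrable_one_sub_sq_rpow hp (g := fun _ => 1) continuous_const
          simp only [one_mul] at hI
          refine hI.continuousOn_mul (ContinuousOn.rpow_const (by fun_prop) fun u hu => Or.inl ?_)
          rw [Set.uIcc_of_le zero_le_one] at hu
          exact (hpos _ (by nlinarith [hu.1, hu.2])).ne'
        · have hu1 : 0 ≤ 1 - u := by linarith [hu.2]
          have h0 := hpos (1 - u) hu1
          have h1 : (A + X * (1 - u ^ 2)) ^ (-κ) ≤ A ^ (-(κ - p - 1)) *
              (A + X * (1 - u)) ^ (-(p + 1)) := by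
            calc (A + X * (1 - u ^ 2)) ^ (-κ) ≤ (A + X * (1 - u)) ^ (-κ) := by
                  refine Real.rpow_le_rpow_of_nonpos h0 ?_ (by linarith)
                  have : 1 - u ≤ 1 - u ^ 2 := by nlinarith [hu.1, hu.2]
                  nlinarith
              _ = (A + X * (1 - u)) ^ (-(κ - p - 1)) * (A + X * (1 - u)) ^ (-(p + 1)) := by
                  rw [← Real.rpow_add h0]; congr 1; ring
              _ ≤ _ := by
                  refine mul_le_mul_of_nonneg_right ?_ (Real.rpow_nonneg h0.le _)
                  refine Real.rpow_le_rpow_of_nonpos hA ?_ (by linarith)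
                  nlinarith
          have h2 : (1 - u ^ 2) ^ (p - 1) ≤ 2 ^ p * (1 - u) ^ (p - 1) := by
            have hu2 : 1 ≤ 1 + u := by linarith [hu.1]
            rw [show 1 - u ^ 2 = (1 + u) * (1 - u) by ring, Real.mul_rpow (by linarith) hu1]
            refine mul_le_mul_of_nonneg_right ?_ (Real.rpow_nonneg hu1 _)
            -- Passing from exponent p - 1 to p avoids distinguishing the sign of p - 1.
            exact (Real.rpow_le_rpow_of_exponent_le hu2 (by linarith)).trans
              (Real.rpow_le_rpow (by linarith) (by linarith [hu.2]) hp.le)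
          calc _ ≤ (A ^ (-(κ - p - 1)) * (A + X * (1 - u)) ^ (-(p + 1))) *
                (2 ^ p * (1 - u) ^ (p - 1)) := by
                refine mul_le_mul h1 h2 (Real.rpow_nonneg (by nlinarith [hu.1, hu.2]) _) ?_
                exact mul_nonneg (Real.rpow_nonneg hA.le _) (Real.rpow_nonneg h0.le _)
            _ = _ := by ring
    _ = 2 ^ p * A ^ (-(κ - p - 1)) *
        ∫ v in (0 : ℝ)..1, (A + X * v) ^ (-(p + 1)) * v ^ (p - 1) := by
        rw [intervalIntegral.integral_const_mul, intervalIntegral.integral_comp_sub_left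
          (fun v => (A + X * v) ^ (-(p + 1)) * v ^ (p - 1)), sub_self, sub_zero]
    _ ≤ 2 ^ p * A ^ (-(κ - p - 1)) * (1 / (p * A)) := by
        gcongr
        exact integral_rpow_mul_add_rpow_neg_le hp hA hX hAX
    _ = 2 ^ p / p * A ^ (-(κ - p)) := by
        rw [show -(κ - p - 1) = -(κ - p) + 1 by ring, Real.rpow_add_one hA.ne']
        field_simp

/-- A probability measure on `[0, 1]` with even moments `(1/2)_i / (β+1)_i`, together with a decay
estimate for the integrals of negative powers against it. -/
structure IsUltrasphericalMeasure (α β η : ℝ) (μ : Measure ℝ) : Prop where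
  isProbabilityMeasure : IsProbabilityMeasure μ
  ae_mem : ∀ᵐ u ∂μ, u ∈ Set.Icc (0 : ℝ) 1
  moment : ∀ i : ℕ, ∫ u, u ^ (2 * i) ∂μ =
    (ascPochhammer ℝ i).eval (1 / 2) / (ascPochhammer ℝ i).eval (β + 1)
  decay : ∃ C : ℝ, 0 < C ∧ ∀ A X : ℝ, 0 < A → 0 ≤ X → 1 ≤ A + X →
    ∫ u, (A + X * (1 - u ^ 2)) ^ (-(α + β + 2 - η / 2)) ∂μ ≤ C * A ^ (-(α + 3 / 2 - η / 2))

/-- The limit case β = -1/2: the density degenerates to a point mass at 1, all moments are 1, and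
the two exponents in `decay` coincide. -/
theorem isUltrasphericalMeasure_dirac (α η : ℝ) :
    IsUltrasphericalMeasure α (-(1 / 2)) η (Measure.dirac 1) where
  isProbabilityMeasure := inferInstance
  ae_mem := by rw [ae_dirac_eq]; exact ⟨zero_le_one, le_rfl⟩
  moment i := by
    have h : (ascPochhammer ℝ i).eval (1 / 2) ≠ 0 := (ascPochhammer_pos i (1 / 2) (by norm_num)).ne'
    rw [integral_dirac, one_pow, show -(1 / 2 : ℝ) + 1 = 1 / 2 by norm_num, div_self h]
  decay := by
    refine ⟨1, one_pos, fun A X _ _ _ => le_of_eq ?_⟩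
    rw [integral_dirac, one_mul]
    congr 1 <;> ring

theorem exists_isUltrasphericalMeasure_of_lt {α β η : ℝ} (hβ : -(1 / 2) < β)
    (hη : η ≤ 2 * α + 1) : ∃ μ, IsUltrasphericalMeasure α β η μ := by
  have hp : 0 < β + 1 / 2 := by linarith
  set p := β + 1 / 2 with hpdef
  set I := ∫ u in (0 : ℝ)..1, (1 - u ^ 2) ^ (p - 1) with hI
  have hI0 : 0 < I := integral_one_sub_sq_rpow_pos hp
  set φ : ℝ → ℝ := fun u => I⁻¹ * (1 - u ^ 2) ^ (p - 1) with hφ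
  have hφ0 : ∀ u ∈ Set.Ioc (0 : ℝ) 1, 0 ≤ φ u := fun u hu =>
    mul_nonneg (inv_nonneg.mpr hI0.le) (Real.rpow_nonneg (by nlinarith [hu.1, hu.2]) _)
  have hφm : Measurable φ := by fun_prop
  set μ := (volume.restrict (Set.Ioc (0 : ℝ) 1)).withDensity fun u => ENNReal.ofReal (φ u) with hμ
  have hint : ∀ g : ℝ → ℝ, ∫ u, g u ∂μ =
      I⁻¹ * ∫ u in (0 : ℝ)..1, g u * (1 - u ^ 2) ^ (p - 1) := by
    intro g
    rw [hμ, integral_withDensity_eq_integral_toReal_smul (by fun_prop)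
      (Filter.Eventually.of_forall fun _ => ENNReal.ofReal_lt_top),
      intervalIntegral.integral_of_le zero_le_one, ← integral_const_mul]
    refine setIntegral_congr_fun measurableSet_Ioc fun u hu => ?_
    simp only [smul_eq_mul]
    rw [ENNReal.toReal_ofReal (hφ0 u hu), hφ]; ring
  refine ⟨μ, ⟨⟨?_⟩, ?_, fun i => ?_, ?_⟩⟩
  · have hφi : IntegrableOn φ (Set.Ioc 0 1) := by
      have := (intervalIntegrable_one_sub_sq_rpow hp (g := fun _ => I⁻¹) continuous_const)
      rwa [intervalIntegrable_iff_integrableOn_Ioc_of_le zero_le_one] at this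
    rw [hμ, withDensity_apply _ MeasurableSet.univ, Measure.restrict_univ,
      ← ofReal_integral_eq_lintegral_ofReal hφi
        ((ae_restrict_iff' measurableSet_Ioc).mpr (Filter.Eventually.of_forall hφ0)),
      ← intervalIntegral.integral_of_le zero_le_one, hφ, intervalIntegral.integral_const_mul,
      ← hI, inv_mul_cancel₀ hI0.ne', ENNReal.ofReal_one]
  · refine (withDensity_absolutelyContinuous _ _).ae_le ?_
    refine (ae_restrict_iff' measurableSet_Ioc).mpr (Filter.Eventually.of_forall fun u hu => ?_)
    exact ⟨hu.1.le, hu.2⟩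
  · rw [hint, integral_pow_mul_one_sub_sq_rpow hp, ← hI, ← mul_assoc, inv_mul_cancel₀ hI0.ne',
      one_mul, show p + 1 / 2 = β + 1 by rw [hpdef]; ring]
  · refine ⟨I⁻¹ * (2 ^ p / p), by positivity, fun A X hA hX hAX => ?_⟩
    rw [hint, mul_assoc]
    refine mul_le_mul_of_nonneg_left ?_ (by positivity)
    have := integral_add_rpow_neg_mul_one_sub_sq_rpow_le (κ := α + β + 2 - η / 2) hp
      (by rw [hpdef]; linarith) hA hX hAX
    rwa [show α + β + 2 - η / 2 - p = α + 3 / 2 - η / 2 by rw [hpdef]; ring] at this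

/-- For β > -1/2 the decay estimate needs η ≤ 2α + 1, which leaves room for η > 0 because α ≥ β; for
the point mass any η works. -/
theorem exists_isUltrasphericalMeasure {α β : ℝ} (hβ : -(1 / 2) ≤ β) (hαβ : β ≤ α) :
    ∃ η : ℝ, 0 < η ∧ η < 1 ∧ ∃ μ, IsUltrasphericalMeasure α β η μ := by
  rcases hβ.eq_or_lt with rfl | h
  · exact ⟨1 / 2, by norm_num, by norm_num, _, isUltrasphericalMeasure_dirac α _⟩
  · exact ⟨min (1 / 2) (2 * α + 1), lt_min (by norm_num) (by linarith),
      (min_le_left _ _).trans_lt (by norm_num),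
      exists_isUltrasphericalMeasure_of_lt h (min_le_right _ _)⟩

/-! ### The Cesàro kernel of Jacobi series -/

theorem choose_natCast_add_eq (δ : ℝ) (m : ℕ) :
    Ring.choose ((m : ℝ) + δ) m = risingCoeff (δ + 1) m := by
  rw [← choose_eq_risingCoeff]; congr 1; ring

theorem risingCoeff_one (m : ℕ) : risingCoeff (1 : ℝ) m = 1 := by
  rw [risingCoeff, ascPochhammer_eval_one, div_self (by exact_mod_cast m.factorial_ne_zero)]

/-- The kernel of the `(C, δ)` means of Jacobi series. -/
def cesaroKernel (α β δ : ℝ) (n : ℕ) (t : ℝ) : ℝ :=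
  (Ring.choose ((n : ℝ) + δ) n)⁻¹ * ∑ k ∈ Finset.range (n + 1),
    Ring.choose (((n - k : ℕ) : ℝ) + δ) (n - k) * jacobiZ α β k t

theorem continuous_jacobiZ (α β : ℝ) (n : ℕ) : Continuous (jacobiZ α β n) := by
  unfold jacobiZ jacobiP
  fun_prop

theorem IsUltrasphericalMeasure.integrable {α β η : ℝ} {μ : Measure ℝ}
    (hμ : IsUltrasphericalMeasure α β η μ) {g : ℝ → ℝ} (hg : ContinuousOn g (Set.Icc 0 1))
    (hgm : Measurable g) : Integrable g μ := by
  have := hμ.isProbabilityMeasure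
  obtain ⟨C, hC⟩ := isCompact_Icc.exists_bound_of_continuousOn hg
  exact Integrable.of_bound hgm.aestronglyMeasurable C (hμ.ae_mem.mono hC)

theorem jacobiSum_eq_integral {α β η : ℝ} {μ : Measure ℝ} (hμ : IsUltrasphericalMeasure α β η μ)
    (j : ℕ) (x : ℝ) :
    jacobiSum α β j (x ^ 2) = ∫ u, gegenbauerEven (α + β + 2) j (x * u) ∂μ := by
  have hint : ∀ k : ℕ, Integrable (fun u : ℝ => u ^ k) μ := fun k =>
    hμ.integrable (continuous_pow k).continuousOn (by fun_prop)
  have h : ∀ u : ℝ, gegenbauerEven (α + β + 2) j (x * u) = ∑ i ∈ Finset.range (j + 1),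
      (risingCoeff (α + β + 2) (j + i) * ((j + i).choose (j - i) : ℝ) * 4 ^ i *
        (-1) ^ (j - i) * (x ^ 2) ^ i) * u ^ (2 * i) := by
    intro u
    refine Finset.sum_congr rfl fun i _ => ?_
    rw [← mul_assoc 2 x u, mul_pow (2 * x) u, pow_mul (2 * x), mul_pow 2 x, mul_pow (2 ^ 2)]
    norm_num
    ring
  simp only [h]
  rw [integral_finsetSum _ fun i _ => (hint _).const_mul _, jacobiSum]
  refine Finset.sum_congr rfl fun i hi => ?_
  rw [integral_const_mul, hμ.moment, mul_div_assoc,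
    ← jacobiSum_coeff (α + β + 2) (β + 1) (Nat.lt_succ_iff.mp (Finset.mem_range.mp hi))]
  ring

theorem cesaroKernel_eq_integral {α β η : ℝ} {μ : Measure ℝ}
    (hμ : IsUltrasphericalMeasure α β η μ) (hα : -1 < α) (hβ : -1 < β) (n : ℕ) (x : ℝ) :
    cesaroKernel α β (α + β + 2) n (2 * x ^ 2 - 1) = (risingCoeff (α + β + 2 + 1) n)⁻¹ *
      ∫ u, cesaroGegenbauer (α + β + 2) n (x * u) ∂μ := by
  have hint : ∀ j : ℕ, Integrable (fun u : ℝ => gegenbauerEven (α + β + 2) j (x * u)) μ := by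
    intro j
    have : Continuous fun u : ℝ => gegenbauerEven (α + β + 2) j (x * u) := by
      unfold gegenbauerEven; fun_prop
    exact hμ.integrable this.continuousOn this.measurable
  rw [cesaroKernel]
  simp only [choose_natCast_add_eq]
  congr 1
  -- Split the order as d + 1: the inner sums have all weights 1, so they are plain partial sums of
  -- Z_k.
  rw [sum_risingCoeff_add_mul]
  simp only [cesaroGegenbauer]
  rw [integral_finsetSum _ fun j _ => (hint j).const_mul _]
  refine Finset.sum_congr rfl fun j _ => ?_
  simp only [risingCoeff_one, one_mul]
  rw [integral_const_mul, sum_jacobiZ hα hβ, ← jacobiSum_eq_integral hμ]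
  congr 2; ring

theorem exists_abs_cesaroKernel_le {α β : ℝ} (hβ : -(1 / 2) ≤ β) (hαβ : β ≤ α) :
    ∃ η : ℝ, 0 < η ∧ η < 1 ∧ ∃ C : ℝ, 0 < C ∧ ∀ (n : ℕ) (t : ℝ), t ∈ Set.Icc (-1 : ℝ) 1 →
      |cesaroKernel α β (α + β + 2) n t| ≤ C * ((n : ℝ) + 1) ^ (η - 1) *
        (1 / ((n : ℝ) + 1) ^ 2 + (1 - t) / 2) ^ (-(α + 3 / 2 - η / 2)) := by
  obtain ⟨η, hη0, hη1, μ, hμ⟩ := exists_isUltrasphericalMeasure hβ hαβ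
  obtain ⟨C₁, hC₁, hdecay⟩ := hμ.decay
  set d := α + β + 2 with hd
  have hd1 : 1 ≤ d := by rw [hd]; linarith
  obtain ⟨C₂, hC₂, hgeg⟩ := exists_abs_cesaroGegenbauer_le (d := d) (η := η) (by linarith) hη0.le
    (by linarith) (by linarith)
  have := hμ.isProbabilityMeasure
  refine ⟨η, hη0, hη1, (1 + d) ^ d * C₂ * C₁, by positivity, fun n t ht => ?_⟩
  have hN : (0 : ℝ) < (n : ℝ) + 1 := by positivity
  have hN2 : 0 < 1 / ((n : ℝ) + 1) ^ 2 := by positivity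
  set X : ℝ := (t + 1) / 2 with hX
  have hX0 : 0 ≤ X := by rw [hX]; linarith [ht.1]
  have hX1 : X ≤ 1 := by rw [hX]; linarith [ht.2]
  set x : ℝ := √X with hx
  have hx2 : x ^ 2 = X := Real.sq_sqrt hX0
  set A : ℝ := 1 / ((n : ℝ) + 1) ^ 2 + (1 - t) / 2 with hA
  have hA0 : 0 < A := by
    have : 0 ≤ (1 - t) / 2 := by linarith [ht.2]
    positivity
  have hAX : 1 ≤ A + X := by rw [hA, hX]; linarith
  have ht' : t = 2 * x ^ 2 - 1 := by rw [hx2, hX]; ring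
  have hpos : ∀ u ∈ Set.Icc (0 : ℝ) 1, 0 < A + X * (1 - u ^ 2) := by
    intro u hu
    have : 0 ≤ 1 - u ^ 2 := by nlinarith [hu.1, hu.2]
    positivity
  have hI1 : Integrable (fun u => (A + X * (1 - u ^ 2)) ^ (-(d - η / 2))) μ :=
    hμ.integrable (ContinuousOn.rpow_const (by fun_prop) fun u hu => Or.inl (hpos u hu).ne')
      (by fun_prop)
  have hle : |∫ u, cesaroGegenbauer d n (x * u) ∂μ| ≤
      C₂ * ((n : ℝ) + 1) ^ (d + η - 1) * (C₁ * A ^ (-(α + 3 / 2 - η / 2))) := by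
    calc |∫ u, cesaroGegenbauer d n (x * u) ∂μ|
        ≤ ∫ u, C₂ * ((n : ℝ) + 1) ^ (d + η - 1) * (A + X * (1 - u ^ 2)) ^ (-(d - η / 2)) ∂μ := by
          rw [← Real.norm_eq_abs]
          refine norm_integral_le_of_norm_le (hI1.const_mul _) (hμ.ae_mem.mono fun u hu => ?_)
          have hu2 : u ^ 2 ≤ 1 := by nlinarith [hu.1, hu.2]
          have h1 := hgeg n (x * u) (by rw [mul_pow, hx2]; nlinarith [sq_nonneg u])
          rw [mul_pow, hx2, show 1 / ((n : ℝ) + 1) ^ 2 + (1 - X * u ^ 2) = A + X * (1 - u ^ 2) by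
            rw [hA, hX]; ring] at h1
          exact h1
      _ ≤ _ := by
          rw [integral_const_mul]
          gcongr
          exact hdecay A X hA0 hX0 hAX
  have hrc := rpow_le_risingCoeff (d := d) (by linarith) n
  have hrc0 : 0 < (((n : ℝ) + 1) / (1 + d)) ^ d := by positivity
  rw [ht', cesaroKernel_eq_integral hμ (by linarith) (by linarith), abs_mul, abs_inv,
    abs_of_pos (risingCoeff_pos (by linarith) n)]
  calc (risingCoeff (d + 1) n)⁻¹ * |∫ u, cesaroGegenbauer d n (x * u) ∂μ|
      ≤ ((((n : ℝ) + 1) / (1 + d)) ^ d)⁻¹ *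
        (C₂ * ((n : ℝ) + 1) ^ (d + η - 1) * (C₁ * A ^ (-(α + 3 / 2 - η / 2)))) := by
        gcongr
    _ = (1 + d) ^ d * C₂ * C₁ * ((n : ℝ) + 1) ^ (η - 1) * A ^ (-(α + 3 / 2 - η / 2)) := by
        rw [Real.div_rpow hN.le (by linarith), show d + η - 1 = d + (η - 1) by ring,
          Real.rpow_add hN d (η - 1)]
        have h1 : ((n : ℝ) + 1) ^ d ≠ 0 := (Real.rpow_pos_of_pos hN d).ne'
        generalize ((n : ℝ) + 1) ^ d = P at h1
        generalize ((n : ℝ) + 1) ^ (η - 1) = Q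
        field_simp

/-! ### The mass of a cap -/

/-- Absorbing sin φ as the square root of (1 - cos φ)(1 + cos φ) raises both exponents by 1/2, so
for α, β ≥ -1/2 the integrand is continuous. -/
theorem jacobiMass_eq {α β θ : ℝ} (h0 : 0 ≤ θ) (hπ : θ ≤ Real.pi) :
    jacobiMass α β θ = ∫ φ in (0 : ℝ)..θ,
      (1 - Real.cos φ) ^ (α + 1 / 2) * (1 + Real.cos φ) ^ (β + 1 / 2) := by
  rw [jacobiMass, intervalIntegral.integral_of_le h0, intervalIntegral.integral_of_le h0,
    integral_Ioc_eq_integral_Ioo, integral_Ioc_eq_integral_Ioo]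
  refine setIntegral_congr_fun measurableSet_Ioo fun φ hφ => ?_
  have hφπ : φ < Real.pi := hφ.2.trans_le hπ
  have hs := Real.sin_pos_of_pos_of_lt_pi hφ.1 hφπ
  have hsq := Real.sin_sq_add_cos_sq φ
  have h1 : 0 < 1 - Real.cos φ := by nlinarith [Real.neg_one_le_cos φ, Real.cos_le_one φ]
  have h2 : 0 < 1 + Real.cos φ := by nlinarith [Real.neg_one_le_cos φ, Real.cos_le_one φ]
  have h3 : Real.sin φ = (1 - Real.cos φ) ^ (1 / 2 : ℝ) * (1 + Real.cos φ) ^ (1 / 2 : ℝ) := by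
    rw [← Real.mul_rpow h1.le h2.le, ← Real.sqrt_eq_rpow,
      show (1 - Real.cos φ) * (1 + Real.cos φ) = Real.sin φ ^ 2 by linarith, Real.sqrt_sq hs.le]
  rw [h3, Real.rpow_add h1, Real.rpow_add h2]
  ring

theorem continuous_one_sub_cos_rpow_mul {α β : ℝ} (hα : -(1 / 2) ≤ α) (hβ : -(1 / 2) ≤ β) :
    Continuous fun φ => (1 - Real.cos φ) ^ (α + 1 / 2) * (1 + Real.cos φ) ^ (β + 1 / 2) :=
  (Continuous.rpow_const (by fun_prop) fun _ => Or.inr (by linarith)).mul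
    (Continuous.rpow_const (by fun_prop) fun _ => Or.inr (by linarith))

theorem jacobiMass_pos {α β θ : ℝ} (hα : -(1 / 2) ≤ α) (hβ : -(1 / 2) ≤ β) (h0 : 0 < θ)
    (hπ : θ ≤ Real.pi) : 0 < jacobiMass α β θ := by
  rw [jacobiMass_eq h0.le hπ]
  refine intervalIntegral.intervalIntegral_pos_of_pos_on
    ((continuous_one_sub_cos_rpow_mul hα hβ).intervalIntegrable _ _) (fun φ hφ => ?_) h0
  have hs := Real.sin_pos_of_pos_of_lt_pi hφ.1 (hφ.2.trans_le hπ)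
  have hsq := Real.sin_sq_add_cos_sq φ
  have h1 : 0 < 1 - Real.cos φ := by nlinarith [Real.neg_one_le_cos φ, Real.cos_le_one φ]
  have h2 : 0 < 1 + Real.cos φ := by nlinarith [Real.neg_one_le_cos φ, Real.cos_le_one φ]
  exact mul_pos (Real.rpow_pos_of_pos h1 _) (Real.rpow_pos_of_pos h2 _)

theorem jacobiMass_le {α β θ : ℝ} (hα : -(1 / 2) ≤ α) (hβ : -(1 / 2) ≤ β) (h0 : 0 < θ)
    (hπ : θ ≤ Real.pi) : jacobiMass α β θ ≤ 2 ^ (β + 1 / 2) * θ ^ (2 * α + 2) := by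
  rw [jacobiMass_eq h0.le hπ]
  calc ∫ φ in (0 : ℝ)..θ, (1 - Real.cos φ) ^ (α + 1 / 2) * (1 + Real.cos φ) ^ (β + 1 / 2)
      ≤ ∫ _φ in (0 : ℝ)..θ, θ ^ (2 * α + 1) * 2 ^ (β + 1 / 2) := by
        refine intervalIntegral.integral_mono_on h0.le
          ((continuous_one_sub_cos_rpow_mul hα hβ).intervalIntegrable _ _)
          intervalIntegrable_const fun φ hφ => ?_
        have hc1 := Real.neg_one_le_cos φ
        have hc2 := Real.cos_le_one φ
        have hc3 := Real.one_sub_sq_div_two_le_cos (x := φ)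
        have h1 : (1 - Real.cos φ) ^ (α + 1 / 2) ≤ θ ^ (2 * α + 1) := by
          rw [show 2 * α + 1 = ((2 : ℕ) : ℝ) * (α + 1 / 2) by push_cast; ring,
            Real.rpow_mul h0.le, Real.rpow_natCast]
          refine Real.rpow_le_rpow (by linarith) ?_ (by linarith)
          nlinarith [hφ.1, hφ.2]
        have h2 : (1 + Real.cos φ) ^ (β + 1 / 2) ≤ 2 ^ (β + 1 / 2) :=
          Real.rpow_le_rpow (by linarith) (by linarith) (by linarith)
        exact mul_le_mul h1 h2 (Real.rpow_nonneg (by linarith) _) (by positivity)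
    _ = 2 ^ (β + 1 / 2) * θ ^ (2 * α + 2) := by
        rw [intervalIntegral.integral_const, smul_eq_mul, sub_zero,
          show 2 * α + 2 = (2 * α + 1) + 1 by ring, Real.rpow_add_one h0.ne' (2 * α + 1)]
        ring

/-! ### Domination of the kernel by caps -/

/-- Take the least j with arccos t ≤ 2^j / N. For j = 0 the term 1/N² suffices; otherwise minimality
bounds 2^j / N by 2 arccos t, and (arccos t / π)² ≤ (1 - t)/2. Since π N ≤ 4N ≤ 2^(n+2), j is at
most n + 2. -/
theorem exists_dyadic_cap (n : ℕ) {t : ℝ} (ht : t ∈ Set.Icc (-1 : ℝ) 1) :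
    ∃ j < n + 3, Real.cos (min Real.pi (2 ^ j / ((n : ℝ) + 1))) ≤ t ∧
      (2 ^ j / ((n : ℝ) + 1) / (2 * Real.pi)) ^ 2 ≤ 1 / ((n : ℝ) + 1) ^ 2 + (1 - t) / 2 := by
  have hN : (0 : ℝ) < (n : ℝ) + 1 := by positivity
  have hpi := Real.pi_gt_three
  set θ := Real.arccos t with hθ
  have hθ0 : 0 ≤ θ := Real.arccos_nonneg t
  have hθπ : θ ≤ Real.pi := Real.arccos_le_pi t
  have hcos : Real.cos θ = t := Real.cos_arccos ht.1 ht.2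
  have hex : ∃ j : ℕ, θ ≤ 2 ^ j / ((n : ℝ) + 1) := by
    refine ⟨n + 2, hθπ.trans ?_⟩
    rw [le_div_iff₀ hN]
    have : ((n + 1 : ℕ) : ℝ) ≤ ((2 ^ n : ℕ) : ℝ) := by exact_mod_cast Nat.lt_two_pow_self
    push_cast at this
    rw [pow_add]
    nlinarith [Real.pi_le_four]
  classical
  have hj := Nat.find_spec hex
  have hjle : Nat.find hex ≤ n + 2 := by
    refine Nat.find_min' hex (hθπ.trans ?_)
    rw [le_div_iff₀ hN]
    have : ((n + 1 : ℕ) : ℝ) ≤ ((2 ^ n : ℕ) : ℝ) := by exact_mod_cast Nat.lt_two_pow_self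
    push_cast at this
    rw [pow_add]
    nlinarith [Real.pi_le_four]
  refine ⟨Nat.find hex, by omega, ?_, ?_⟩
  · rw [← hcos]
    exact Real.cos_le_cos_of_nonneg_of_le_pi hθ0 (min_le_left _ _) (le_min hθπ hj)
  · rcases Nat.eq_zero_or_pos (Nat.find hex) with h | h
    · have h1 : 0 ≤ (1 - t) / 2 := by linarith [ht.2]
      rw [h, pow_zero, div_pow, div_pow, one_pow]
      have h2 : 1 / ((n : ℝ) + 1) ^ 2 / (2 * Real.pi) ^ 2 ≤ 1 / ((n : ℝ) + 1) ^ 2 :=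
        div_le_self (by positivity) (by nlinarith)
      linarith
    · obtain ⟨i, hi⟩ := Nat.exists_eq_add_of_le' h
      have hlt := Nat.find_min hex (m := i) (by omega)
      rw [not_le] at hlt
      have h1 : 2 ^ Nat.find hex / ((n : ℝ) + 1) / (2 * Real.pi) ≤ θ / Real.pi := by
        rw [hi, pow_succ, div_le_div_iff₀ (by positivity) (by positivity)]
        rw [show (2 : ℝ) ^ i * 2 / ((n : ℝ) + 1) * Real.pi =
          (2 ^ i / ((n : ℝ) + 1)) * (2 * Real.pi) by ring]
        gcongr
      have h2 := Real.cos_le_one_sub_mul_cos_sq (x := θ) (by rwa [abs_of_nonneg hθ0])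
      rw [hcos] at h2
      have h3 : (θ / Real.pi) ^ 2 ≤ (1 - t) / 2 := by
        have e : (θ / Real.pi) ^ 2 = (2 / Real.pi ^ 2 * θ ^ 2) / 2 := by
          have := Real.pi_ne_zero
          field_simp
        rw [e]; linarith
      have h4 : 0 < 1 / ((n : ℝ) + 1) ^ 2 := by positivity
      have h5 : (2 ^ Nat.find hex / ((n : ℝ) + 1) / (2 * Real.pi)) ^ 2 ≤ (θ / Real.pi) ^ 2 := by
        gcongr
      linarith

theorem exists_cesaroKernel_le_sum_caps {α β : ℝ} (hβ : -(1 / 2) ≤ β) (hαβ : β ≤ α) :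
    ∃ C : ℝ, 0 < C ∧ ∀ n : ℕ, ∃ c θ : ℕ → ℝ, (∀ j, 0 ≤ c j) ∧
      (∀ j, θ j ∈ Set.Ioc 0 Real.pi) ∧
      (∀ t ∈ Set.Icc (-1 : ℝ) 1, |cesaroKernel α β (α + β + 2) n t| ≤
        ∑ j ∈ Finset.range (n + 3), c j * (Set.Icc (Real.cos (θ j)) 1).indicator 1 t) ∧
      ∑ j ∈ Finset.range (n + 3), c j * jacobiMass α β (θ j) ≤ C := by
  obtain ⟨η, hη0, hη1, C₁, hC₁, hK⟩ := exists_abs_cesaroKernel_le hβ hαβ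
  have hα : -(1 / 2) ≤ α := hβ.trans hαβ
  set q := α + 3 / 2 - η / 2 with hq
  have hq0 : 0 < q := by rw [hq]; linarith
  set r : ℝ := 2 ^ (η - 1) with hr
  have hr0 : 0 < r := by positivity
  have hr1 : r < 1 := Real.rpow_lt_one_of_one_lt_of_neg (by norm_num) (by linarith)
  set D := C₁ * (2 * Real.pi) ^ (2 * q) with hD
  have hD0 : 0 < D := by have := Real.pi_pos; positivity
  refine ⟨D * 2 ^ (β + 1 / 2) * (1 - r)⁻¹, by
    have : 0 < 1 - r := by linarith
    positivity, fun n => ?_⟩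
  have hN : (0 : ℝ) < (n : ℝ) + 1 := by positivity
  set τ : ℕ → ℝ := fun j => 2 ^ j / ((n : ℝ) + 1) with hτ
  have hτ0 : ∀ j, 0 < τ j := fun j => by positivity
  have hpi := Real.pi_pos
  set c : ℕ → ℝ := fun j => D * ((n : ℝ) + 1) ^ (η - 1) * τ j ^ (-(2 * q)) with hc
  have hc0 : ∀ j, 0 ≤ c j := fun j => by have := hτ0 j; positivity
  have hθ : ∀ j, min Real.pi (τ j) ∈ Set.Ioc 0 Real.pi := fun j =>
    ⟨lt_min hpi (hτ0 j), min_le_left _ _⟩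
  refine ⟨c, fun j => min Real.pi (τ j), hc0, hθ, fun t ht => ?_, ?_⟩
  · obtain ⟨j, hj, hcos, hA⟩ := exists_dyadic_cap n ht
    refine le_trans ?_ (Finset.single_le_sum (fun i _ => mul_nonneg (hc0 i)
      (Set.indicator_nonneg (fun _ _ => zero_le_one) _)) (Finset.mem_range.mpr hj))
    rw [Set.indicator_of_mem (show t ∈ Set.Icc (Real.cos (min Real.pi (τ j))) 1 from ⟨hcos, ht.2⟩)]
    change _ ≤ c j * 1
    rw [mul_one]
    refine (hK n t ht).trans ?_
    have h1 : (1 / ((n : ℝ) + 1) ^ 2 + (1 - t) / 2) ^ (-q) ≤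
        (2 * Real.pi) ^ (2 * q) * τ j ^ (-(2 * q)) := by
      have h2 : 0 < τ j / (2 * Real.pi) := by have := hτ0 j; positivity
      calc (1 / ((n : ℝ) + 1) ^ 2 + (1 - t) / 2) ^ (-q)
          ≤ ((τ j / (2 * Real.pi)) ^ 2) ^ (-q) :=
            Real.rpow_le_rpow_of_nonpos (by positivity) hA (by linarith)
        _ = (τ j / (2 * Real.pi)) ^ (-(2 * q)) := by
            rw [← Real.rpow_natCast, ← Real.rpow_mul h2.le]; congr 1; push_cast; ring
        _ = _ := by
            rw [Real.div_rpow (hτ0 j).le (by positivity),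
              Real.rpow_neg (by positivity : (0 : ℝ) ≤ 2 * Real.pi), div_inv_eq_mul, mul_comm]
    calc C₁ * ((n : ℝ) + 1) ^ (η - 1) * (1 / ((n : ℝ) + 1) ^ 2 + (1 - t) / 2) ^ (-q)
        ≤ C₁ * ((n : ℝ) + 1) ^ (η - 1) * ((2 * Real.pi) ^ (2 * q) * τ j ^ (-(2 * q))) := by
          gcongr
      _ = c j := by rw [hc, hD]; ring
  · have hterm : ∀ j, c j * jacobiMass α β (min Real.pi (τ j)) ≤
        D * 2 ^ (β + 1 / 2) * r ^ j := by
      intro j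
      have h1 : jacobiMass α β (min Real.pi (τ j)) ≤ 2 ^ (β + 1 / 2) * τ j ^ (2 * α + 2) := by
        refine (jacobiMass_le hα hβ (hθ j).1 (hθ j).2).trans ?_
        exact mul_le_mul_of_nonneg_left (Real.rpow_le_rpow (hθ j).1.le (min_le_right _ _)
          (by linarith)) (by positivity)
      calc c j * jacobiMass α β (min Real.pi (τ j))
          ≤ c j * (2 ^ (β + 1 / 2) * τ j ^ (2 * α + 2)) :=
            mul_le_mul_of_nonneg_left h1 (hc0 j)
        _ = D * 2 ^ (β + 1 / 2) * (((n : ℝ) + 1) ^ (η - 1) *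
            (τ j ^ (-(2 * q)) * τ j ^ (2 * α + 2))) := by rw [hc]; ring
        _ = D * 2 ^ (β + 1 / 2) * r ^ j := by
            -- The exponents combine to η - 1, so N cancels and 2^(j(η-1)) remains; η < 1 makes the
            -- series converge uniformly in n.
            rw [← Real.rpow_add (hτ0 j), show -(2 * q) + (2 * α + 2) = η - 1 by rw [hq]; ring,
              ← Real.mul_rpow hN.le (hτ0 j).le, hτ, mul_div_cancel₀ _ hN.ne', hr,
              ← Real.rpow_natCast, ← Real.rpow_natCast, ← Real.rpow_mul (by norm_num),
              ← Real.rpow_mul (by norm_num), mul_comm (j : ℝ)]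
    calc ∑ j ∈ Finset.range (n + 3), c j * jacobiMass α β (min Real.pi (τ j))
        ≤ ∑ j ∈ Finset.range (n + 3), D * 2 ^ (β + 1 / 2) * r ^ j :=
          Finset.sum_le_sum fun j _ => hterm j
      _ = D * 2 ^ (β + 1 / 2) * ∑ j ∈ Finset.range (n + 3), r ^ j := by rw [Finset.mul_sum]
      _ ≤ D * 2 ^ (β + 1 / 2) * (1 - r)⁻¹ := by
          gcongr
          rw [← tsum_geometric_of_lt_one hr0.le hr1]
          exact (summable_geometric_of_lt_one hr0.le hr1).sum_le_tsum _ fun i _ => by positivity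

/-! ### Convolution and the maximal function -/

section Maximal

variable {d : ℕ} {Ω : Set (EuclideanSpace ℝ (Fin d))} {m : Measure Ω} {w : Ω → ℝ} {α β : ℝ}

namespace AdditionFormula

theorem measurable_T (A : AdditionFormula m w α β) {g : ℝ → ℝ} (hg : Measurable g) (x : Ω) :
    StronglyMeasurable fun y => A.T g x y := by
  have := A.isProbabilityMeasure
  have h : StronglyMeasurable fun q : Ω × (Fin A.k → Set.Icc (-1 : ℝ) 1) =>
      g (A.ξ x q.1 q.2) :=
    (hg.comp (measurable_subtype_coe.comp (A.measurable x))).stronglyMeasurable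
  exact h.integral_prod_right

theorem integrable_comp (A : AdditionFormula m w α β) {g : ℝ → ℝ} (hg : Measurable g) {B : ℝ}
    (hB : ∀ t ∈ Set.Icc (-1 : ℝ) 1, |g t| ≤ B) (x y : Ω) :
    Integrable (fun u => g (A.ξ x y u)) A.τ := by
  have := A.isProbabilityMeasure
  refine Integrable.of_bound (C := B) ?_ (Filter.Eventually.of_forall fun u => hB _ (A.ξ x y u).2)
  have h : Measurable fun u => A.ξ x y u := (A.measurable x).comp measurable_prodMk_left
  exact (hg.comp (measurable_subtype_coe.comp h)).aestronglyMeasurable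

theorem abs_T_le (A : AdditionFormula m w α β) {g : ℝ → ℝ} {B : ℝ}
    (hB : ∀ t ∈ Set.Icc (-1 : ℝ) 1, |g t| ≤ B) (x y : Ω) : |A.T g x y| ≤ B := by
  have := A.isProbabilityMeasure
  have h := norm_integral_le_of_norm_le_const (μ := A.τ) (f := fun u => g (A.ξ x y u)) (C := B)
    (Filter.Eventually.of_forall fun u => hB _ (A.ξ x y u).2)
  rw [probReal_univ, mul_one] at h
  exact h

theorem integrable_mul_T_mul (A : AdditionFormula m w α β) {f : Ω → ℝ}
    (hf : Integrable (fun y => f y * w y) m) {g : ℝ → ℝ} (hg : Measurable g) {B : ℝ}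
    (hB : ∀ t ∈ Set.Icc (-1 : ℝ) 1, |g t| ≤ B) (x : Ω) :
    Integrable (fun y => f y * A.T g x y * w y) m := by
  have h := hf.bdd_mul (c := B) (A.measurable_T hg x).aestronglyMeasurable
    (Filter.Eventually.of_forall fun y => A.abs_T_le hB x y)
  refine h.congr (Filter.Eventually.of_forall fun y => ?_)
  change A.T g x y * (f y * w y) = f y * A.T g x y * w y
  ring

theorem proj_eq_conv (A : AdditionFormula m w α β) (f : Ω → ℝ) (k : ℕ) (x : Ω) :
    proj m w k f x = A.conv f (jacobiZ α β k) x := by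
  simp only [proj, conv, T, A.formula]

theorem conv_sum (A : AdditionFormula m w α β) {f : Ω → ℝ}
    (hf : Integrable (fun y => f y * w y) m) (s : Finset ℕ) (a : ℕ → ℝ) {g : ℕ → ℝ → ℝ}
    (hg : ∀ k, Measurable (g k)) {B : ℕ → ℝ} (hB : ∀ k, ∀ t ∈ Set.Icc (-1 : ℝ) 1, |g k t| ≤ B k)
    (x : Ω) :
    A.conv f (fun t => ∑ k ∈ s, a k * g k t) x = ∑ k ∈ s, a k * A.conv f (g k) x := by
  have hT : ∀ y, A.T (fun t => ∑ k ∈ s, a k * g k t) x y = ∑ k ∈ s, a k * A.T (g k) x y := by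
    intro y
    simp only [T]
    rw [integral_finsetSum _ fun k _ => (A.integrable_comp (hg k) (hB k) x y).const_mul _]
    simp only [integral_const_mul]
  simp only [conv, hT]
  rw [← Finset.sum_congr rfl fun k _ => integral_const_mul (a k) _,
    ← integral_finsetSum _ fun k _ => (A.integrable_mul_T_mul hf (hg k) (hB k) x).const_mul _]
  refine integral_congr_ae (Filter.Eventually.of_forall fun y => ?_)
  simp only [Finset.mul_sum, Finset.sum_mul]
  exact Finset.sum_congr rfl fun k _ => by ring

theorem abs_conv_le (A : AdditionFormula m w α β) (hw : ∀ x, 0 ≤ w x) {f : Ω → ℝ}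
    (hf : Integrable (fun y => f y * w y) m) {g h : ℝ → ℝ}
    (hh : Measurable h) {B : ℝ} (hB : ∀ t ∈ Set.Icc (-1 : ℝ) 1, |h t| ≤ B)
    (hgh : ∀ t ∈ Set.Icc (-1 : ℝ) 1, |g t| ≤ h t) (x : Ω) :
    |A.conv f g x| ≤ A.conv (fun y => |f y|) h x := by
  have hf' : Integrable (fun y => |f y| * w y) m := by
    refine hf.norm.congr (Filter.Eventually.of_forall fun y => ?_)
    change |f y * w y| = |f y| * w y
    rw [abs_mul, abs_of_nonneg (hw y)]
  rw [conv, ← Real.norm_eq_abs]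
  refine norm_integral_le_of_norm_le (A.integrable_mul_T_mul hf' hh hB x)
    (Filter.Eventually.of_forall fun y => ?_)
  rw [Real.norm_eq_abs, abs_mul, abs_mul, abs_of_nonneg (hw y)]
  have hT : |A.T g x y| ≤ A.T h x y := by
    rw [T, ← Real.norm_eq_abs]
    exact norm_integral_le_of_norm_le (A.integrable_comp hh hB x y)
      (Filter.Eventually.of_forall fun u => hgh _ (A.ξ x y u).2)
  have := hw y
  gcongr

theorem conv_indicator_le (A : AdditionFormula m w α β) (hα : -(1 / 2) ≤ α) (hβ : -(1 / 2) ≤ β)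
    (f : Ω → ℝ) (x : Ω) (hM : A.maximalFunction f x ≠ ⊤) {θ : ℝ} (hθ : θ ∈ Set.Ioc 0 Real.pi) :
    A.conv (fun y => |f y|) ((Set.Icc (Real.cos θ) 1).indicator 1) x ≤
      jacobiMass α β θ * (A.maximalFunction f x).toReal := by
  have hpos := jacobiMass_pos hα hβ hθ.1 hθ.2
  have h : ENNReal.ofReal (A.conv (fun y => |f y|) ((Set.Icc (Real.cos θ) 1).indicator 1) x /
      jacobiMass α β θ) ≤ A.maximalFunction f x :=
    le_iSup₂ (f := fun θ (_ : θ ∈ Set.Ioc 0 Real.pi) => ENNReal.ofReal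
      (A.conv (fun y => |f y|) ((Set.Icc (Real.cos θ) 1).indicator 1) x / jacobiMass α β θ)) θ hθ
  have h2 := (ENNReal.ofReal_le_iff_le_toReal hM).mp h
  rw [div_le_iff₀ hpos] at h2
  linarith

theorem cesaroMean_eq_conv (A : AdditionFormula m w α β) (δ : ℝ) {f : Ω → ℝ}
    (hf : Integrable (fun y => f y * w y) m) (n : ℕ) (x : Ω) :
    cesaroMean m w δ n f x = A.conv f (cesaroKernel α β δ n) x := by
  have hbound : ∀ k, ∃ B, ∀ t ∈ Set.Icc (-1 : ℝ) 1, |jacobiZ α β k t| ≤ B := fun k =>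
    isCompact_Icc.exists_bound_of_continuousOn (continuous_jacobiZ α β k).continuousOn
  choose B hB using hbound
  have h := A.conv_sum hf (Finset.range (n + 1)) (fun k => (Ring.choose ((n : ℝ) + δ) n)⁻¹ *
    Ring.choose (((n - k : ℕ) : ℝ) + δ) (n - k)) (fun k => (continuous_jacobiZ α β k).measurable)
    hB x
  rw [cesaroMean, show cesaroKernel α β δ n = fun t => ∑ k ∈ Finset.range (n + 1),
    (Ring.choose ((n : ℝ) + δ) n)⁻¹ * Ring.choose (((n - k : ℕ) : ℝ) + δ) (n - k) *
      jacobiZ α β k t from ?_, h, Finset.mul_sum]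
  · simp only [A.proj_eq_conv, mul_assoc]
  · funext t
    simp only [cesaroKernel, Finset.mul_sum, mul_assoc]

theorem abs_conv_le_of_caps (A : AdditionFormula m w α β) (hα : -(1 / 2) ≤ α)
    (hβ : -(1 / 2) ≤ β) (hw : ∀ x, 0 ≤ w x) {f : Ω → ℝ}
    (hf : Integrable (fun y => f y * w y) m) {x : Ω} (hM : A.maximalFunction f x ≠ ⊤)
    {g : ℝ → ℝ} (s : Finset ℕ) {c θ : ℕ → ℝ} (hc : ∀ j, 0 ≤ c j)
    (hθ : ∀ j, θ j ∈ Set.Ioc 0 Real.pi) (hle : ∀ t ∈ Set.Icc (-1 : ℝ) 1,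
      |g t| ≤ ∑ j ∈ s, c j * (Set.Icc (Real.cos (θ j)) 1).indicator 1 t) :
    |A.conv f g x| ≤ (∑ j ∈ s, c j * jacobiMass α β (θ j)) * (A.maximalFunction f x).toReal := by
  have hm : ∀ j, Measurable ((Set.Icc (Real.cos (θ j)) 1).indicator (1 : ℝ → ℝ)) := fun j =>
    measurable_one.indicator measurableSet_Icc
  have hb : ∀ j : ℕ, ∀ t ∈ Set.Icc (-1 : ℝ) 1,
      |(Set.Icc (Real.cos (θ j)) 1).indicator (1 : ℝ → ℝ) t| ≤ 1 := by
    intro j t _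
    rw [Set.indicator_apply]
    split_ifs <;> simp
  have hf' : Integrable (fun y => |f y| * w y) m := by
    refine hf.norm.congr (Filter.Eventually.of_forall fun y => ?_)
    change |f y * w y| = |f y| * w y
    rw [abs_mul, abs_of_nonneg (hw y)]
  refine (A.abs_conv_le hw hf (Finset.measurable_fun_sum _ fun j _ => (hm j).const_mul _)
    (B := ∑ j ∈ s, c j) (fun t ht => ?_) hle x).trans ?_
  · refine (Finset.abs_sum_le_sum_abs _ _).trans (Finset.sum_le_sum fun j _ => ?_)
    rw [abs_mul, abs_of_nonneg (hc j)]
    exact mul_le_of_le_one_right (hc j) (hb j t ht)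
  · rw [A.conv_sum hf' s c hm hb, Finset.sum_mul]
    refine Finset.sum_le_sum fun j _ => ?_
    rw [mul_assoc]
    exact mul_le_mul_of_nonneg_left (A.conv_indicator_le hα hβ f x hM (hθ j)) (hc j)

end AdditionFormula

/-- Bounds for Cesàro means pass to Cesàro means of higher order. -/
theorem abs_cesaroMean_le_of_le {δ₀ δ : ℝ} (h0 : -1 < δ₀) (hδ : δ₀ ≤ δ) {f : Ω → ℝ} {x : Ω}
    {B : ℝ} (hB : ∀ n, |cesaroMean m w δ₀ n f x| ≤ B) (n : ℕ) :
    |cesaroMean m w δ n f x| ≤ B := by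
  have hpos : ∀ j, 0 < risingCoeff (δ₀ + 1) j := fun j => risingCoeff_pos (by linarith) j
  have hγ : ∀ j, 0 ≤ risingCoeff (δ - δ₀) j := fun j => risingCoeff_nonneg (by linarith) j
  have hinner : ∀ j, ∑ k ∈ Finset.range (j + 1), risingCoeff (δ₀ + 1) (j - k) * proj m w k f x =
      risingCoeff (δ₀ + 1) j * cesaroMean m w δ₀ j f x := by
    intro j
    rw [cesaroMean]
    simp only [choose_natCast_add_eq]
    rw [← mul_assoc, mul_inv_cancel₀ (hpos j).ne', one_mul]
  have hsum := sum_risingCoeff_add_mul (δ - δ₀) (δ₀ + 1) (fun k => proj m w k f x) n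
  -- The nonnegative weights sum exactly to the normalizing coefficient, so the higher mean is a
  -- convex combination of the lower ones.
  have htot := risingCoeff_add (δ - δ₀) (δ₀ + 1) n
  rw [← Finset.Nat.sum_antidiagonal_swap, Finset.Nat.sum_antidiagonal_eq_sum_range_succ_mk] at htot
  simp only [Prod.fst_swap, Prod.snd_swap] at htot
  rw [show δ - δ₀ + (δ₀ + 1) = δ + 1 by ring] at hsum htot
  rw [cesaroMean]
  simp only [choose_natCast_add_eq]
  have hn : 0 < risingCoeff (δ + 1) n := risingCoeff_pos (by linarith) n
  rw [hsum, abs_mul, abs_inv, abs_of_pos hn, inv_mul_le_iff₀ hn, ← htot, Finset.sum_mul]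
  refine (Finset.abs_sum_le_sum_abs _ _).trans (Finset.sum_le_sum fun j _ => ?_)
  rw [hinner, abs_mul, abs_mul, abs_of_nonneg (hγ _), abs_of_pos (hpos j), ← mul_assoc]
  exact mul_le_mul_of_nonneg_left (hB j) (mul_nonneg (hγ _) (hpos j).le)

end Maximal

end FourierOrthogonal

end

theorem mainTheorem11 (α β δ : ℝ) (hβ : -(1 / 2) ≤ β) (hαβ : β ≤ α) (hδ : α + β + 2 ≤ δ) :
    ∃ c : ℝ, 0 < c ∧
      ∀ (d : ℕ) (Ω : Set (EuclideanSpace ℝ (Fin d))) (_ : IsCompact Ω)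
        (m : MeasureTheory.Measure Ω) (w : Ω → ℝ) (_ : FourierOrthogonal.IsWeight m w)
        (A : FourierOrthogonal.AdditionFormula m w α β)
        (f : Ω → ℝ) (_ : MeasureTheory.Integrable (fun y => f y * w y) m) (x : Ω),
        FourierOrthogonal.cesaroMax m w δ f x ≤ ENNReal.ofReal c * A.maximalFunction f x := by
  obtain ⟨C, hC, hK⟩ := FourierOrthogonal.exists_cesaroKernel_le_sum_caps hβ hαβ
  refine ⟨C, hC, fun d Ω _ m w hw A f hf x => ?_⟩
  -- An infinite maximal function makes the bound trivial since C > 0; otherwise the estimate can be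
  -- carried out in the reals.
  rcases eq_or_ne (A.maximalFunction f x) ⊤ with hM | hM
  · rw [hM, ENNReal.mul_top (ENNReal.ofReal_pos.mpr hC).ne']
    exact le_top
  refine iSup_le fun n => ?_
  rw [← ENNReal.ofReal_toReal hM, ← ENNReal.ofReal_mul hC.le]
  refine ENNReal.ofReal_le_ofReal
    (FourierOrthogonal.abs_cesaroMean_le_of_le (by linarith) hδ (fun j => ?_) n)
  obtain ⟨c, θ, hc, hθ, hle, hmass⟩ := hK j
  rw [A.cesaroMean_eq_conv _ hf]
  exact (A.abs_conv_le_of_caps (hβ.trans hαβ) hβ hw.nonneg hf hM _ hc hθ hle).trans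
    (mul_le_mul_of_nonneg_right hmass ENNReal.toReal_nonneg)
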